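/- Let $H$ be a real Hilbert space with identity operator $I$. For bounded self-adjoint operators $U,V$ on $H$ write $U\succeq V$ if $\langle Ux,x\rangle\ge\langle Vx,x\rangle$ for all $x\in H$, and for $\alpha>0$ let $\mathcal P_\alpha(H)$ be the set of bounded self-adjoint operators $U$ with $U\succeq\alpha I$. For $W\in\mathcal P_\alpha(H)$ put $\|x\|_W=\sqrt{\langle Wx,x\rangle}$. For a set-valued operator $M:H\to 2^H$ let $J_M=(I+M)^{-1}$ be its resolvent and $\operatorname{zer}M=\{x\in H: 0\in Mx\}$. Let $A:H\to 2^H$ be maximal monotone, and let $B:H\to H$ be $\beta$-cocoercive for some $\beta>0$, i.e. $\langle x-y,Bx-By\rangle\ge\beta\|Bx-By\|^2$ for all $x,y\in H$. Suppose that $\Omega:=\operatorname{zer}(A+B)\ne\emptyset$. Let $\alpha>0$, let $(\eta_k)_{k\ge0}$ be a summable sequence in $[0,+\infty)$, and let $(U_k)_{k\ge0}$ be a sequence in $\mathcal P_\alpha(H)$ such that $$\mu:=\sup_{k}\|U_k\|<+\infty\quad\text{and}\quad(1+\eta_k)U_{k+1}\succeq U_k\quad\text{for all }k\ge0.$$ Let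 $\gamma_k>0$ with $\gamma_k\|U_k\|<2\beta$, put $\alpha_k=\frac{2\beta}{4\beta-\gamma_k\|U_k\|}$, and let $0<\lambda_k<\frac1{\alpha_k}$. Let $(a_k)$ and $(b_k)$ be sequences in $H$ with $\sum_k\lambda_k\|a_k\|<+\infty$ and $\sum_k\lambda_k\|b_k\|<+\infty$. Let $x_0\in H$ and, for $k\ge0$, $$y_k=x_k-\gamma_kU_k(Bx_k+b_k),\qquad x_{k+1}=x_k+\lambda_k\bigl(J_{\gamma_kU_kA}(y_k)+a_k-x_k\bigr).$$ Then: (i) for every $x^*\in\Omega$, $\lim_{k\to\infty}\|x_k-x^*\|_{U_k^{-1}}$ exists. Suppose moreover that (a) $\sum_{k}\lambda_k\bigl(\frac1{\alpha_k}-\lambda_k\bigr)=+\infty$; (b) there are $\underline\gamma>0$ and $\epsilon\in(0,2\beta-\mu\underline\gamma)$ such that $\underline\gamma\le\gamma_k$ and $\gamma_k\mu\le 2\beta-\epsilon$ for all $k$; (c) $\sum_k|\gamma_{k+1}-\gamma_k|<+\infty$, $\sum_k\bigl|\gamma_{k+1}\|U_{k+1}\|-\gamma_k\|U_k\|\bigr|<+\infty$,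 and $\sum_k\|U_k^{-1}x-U_{k+1}^{-1}x\|<+\infty$ for every $x\in H$. Then: (ii) $\lim_{k\to\infty}\|x_k-J_{\gamma_kU_kA}(x_k-\gamma_kU_kBx_k)\|=0$; (iii) $(x_k)$ converges weakly to a point of $\Omega$; (iv) if in addition there is $\underline\lambda>0$ with $\lambda_k\ge\underline\lambda$ for all $k$, then $Bx_k\to Bx^*$ strongly for every $x^*\in\Omega$. -/

import Mathlib

open Filter Topology
open scoped InnerProductSpace

namespace VMFB

variable {H : Type*} [NormedAddCommGroup H] [InnerProductSpace ℝ H]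

/-- A set-valued operator `A : H → 2^H` is monotone. -/
def IsMonotoneOp (A : H → Set H) : Prop :=
  ∀ x y : H, ∀ u ∈ A x, ∀ v ∈ A y, 0 ≤ ⟪x - y, u - v⟫_ℝ

/-- `A` is maximal monotone: it is monotone and its graph is not strictly contained in the graph
of another monotone operator. -/
def IsMaximalMonotone (A : H → Set H) : Prop :=
  IsMonotoneOp A ∧ ∀ A' : H → Set H, IsMonotoneOp A' → (∀ x, A x ⊆ A' x) → A' = A

/-- `B : H → H` is `β`-cocoercive. -/
def IsCocoercive (β : ℝ) (B : H → H) : Prop :=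
  ∀ x y : H, β * ‖B x - B y‖ ^ 2 ≤ ⟪x - y, B x - B y⟫_ℝ

/-- The sum `A + B` of a set-valued operator and a single-valued operator. -/
def addSingle (A : H → Set H) (B : H → H) : H → Set H :=
  fun x => {w | ∃ u ∈ A x, w = u + B x}

/-- The set of zeros `zer M = {x | 0 ∈ M x}`. -/
def zer (M : H → Set H) : Set H := {x | (0 : H) ∈ M x}

/-- The set-valued operator `γ U A`, that is `x ↦ {γ • U u | u ∈ A x}`. -/
def scaledOp (γ : ℝ) (U : H →L[ℝ] H) (A : H → Set H) : H → Set H :=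
  fun x => {w | ∃ u ∈ A x, w = γ • U u}

/-- The set-valued inverse of `I + M`, evaluated at `y`: all `p` with `y ∈ p + M p`. -/
def invIdAdd (M : H → Set H) (y : H) : Set H := {p | ∃ w ∈ M p, y = p + w}

/-- The resolvent `J_M = (I + M)⁻¹` as a single-valued map: `J_M y` is the (for the operators
considered, existing and unique) element of `(I + M)⁻¹ y`. -/
noncomputable def resolvent (M : H → Set H) (y : H) : H :=
  Classical.epsilon fun p => p ∈ invIdAdd M y

/-- `𝒫_α(H)`: the bounded self-adjoint operators `U` with `U ⪰ α I`
(`≤` on `H →L[ℝ] H` is the Loewner order). -/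
def strongPos [CompleteSpace H] (α : ℝ) : Set (H →L[ℝ] H) :=
  {U | IsSelfAdjoint U ∧ α • (1 : H →L[ℝ] H) ≤ U}

/-- The norm `‖x‖_W = √⟨W x, x⟩`. -/
noncomputable def metricNorm (W : H →L[ℝ] H) (x : H) : ℝ := √⟪W x, x⟫_ℝ

/-- For `α > 0` every `U ∈ 𝒫_α(H)` is invertible, so `U.inverse` is its true inverse `U⁻¹`. -/
theorem inverse_of_mem_strongPos [CompleteSpace H] {α : ℝ} (hα : 0 < α) {U : H →L[ℝ] H}
    (hU : U ∈ strongPos α) : (∀ x, U (U.inverse x) = x) ∧ ∀ x, U.inverse (U x) = x := by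
  have hu : IsUnit U := by
    refine U.isUnit_of_forall_le_norm_inner_map (c := ⟨α, hα.le⟩) hα fun x => ?_
    have h := ((ContinuousLinearMap.le_def _ _).1 hU.2).2 x
    rw [ContinuousLinearMap.reApplyInnerSelf_apply] at h
    simp only [sub_apply, smul_apply,
      one_apply_eq_self, inner_sub_left, inner_smul_left, real_inner_self_eq_norm_sq,
      RCLike.re_to_real, conj_trivial] at h
    refine le_trans ?_ (Real.le_norm_self _)
    change ‖x‖ ^ 2 * α ≤ _
    linarith
  obtain ⟨u, rfl⟩ := hu
  let e := ContinuousLinearEquiv.unitsEquiv ℝ H u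
  have he : (u : H →L[ℝ] H) = (e : H →L[ℝ] H) := rfl
  rw [he, ContinuousLinearMap.inverse_equiv]
  exact ⟨fun x => e.apply_symm_apply x, fun x => e.symm_apply_apply x⟩

/-- The averagedness constant `2β / (4β - γ‖U‖)` of the forward-backward operator. -/
noncomputable def avgConst (β γ : ℝ) (U : H →L[ℝ] H) : ℝ := 2 * β / (4 * β - γ * ‖U‖)

/-- The forward-backward operator `x ↦ J_{γUA}(x - γ U B x)`. -/
noncomputable def fbOp (A : H → Set H) (B : H → H) (γ : ℝ) (U : H →L[ℝ] H) (x : H) : H :=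
  resolvent (scaledOp γ U A) (x - γ • U (B x))

end VMFB

/-! Put `v k = x k - fbOp … (x k)`, `W k = (U k)⁻¹`, `κ = γ‖U‖/(2β)`, so that `1 / avgConst = 2 -
κ`. For a zero `xs` and `z = x k - xs`, the gap `S = 2⟪W z, v⟫ - (2 - κ)⟪W v, v⟫` is nonnegative,
which is averagedness of the forward-backward operator. Since `λ ≤ 2 - κ`, an exact step lowers
`‖z‖_W²` by at least `λ S`. The metric inequality and the summable errors make this quasi-Fejér,
which gives (i) and `∑ λ S < ∞` (`tendsto_metricNorm_and_summable`).

For (ii), cocoercivity yields more than averagedness: `residual_sq_le_gap` bounds `‖v‖⁴` by a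
multiple of `S` as long as `κ` stays away from 0 and 1. Hence `∑ λ ‖v‖⁴ < ∞`, while (a) gives `∑ λ =
∞`, so `v` is small infinitely often. To exclude later excursions, the increments of `v` are bounded
by `λ‖v‖`, summable terms, and `‖(W k - W (k+1)) v k‖`. The last is delicate, because the metrics
vary summably only pointwise; in a Hilbert space this still makes the tail sums uniformly small on
the unit ball (`exists_forall_sum_norm_le_of_summable`), so the term can be absorbed
(`tendsto_norm_zero_of_variation`).

For (iii) and (iv), cocoercivity and `v → 0` give `B (x k) → B xs` strongly. Weak cluster points are
then zeros because the graph of `A` is weak-strong closed, and Opial's argument in the strongly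
convergent metrics `W k` shows that the cluster point is unique. That the resolvents are defined
everywhere is Minty's theorem, proved by minimising over the epigraph of the Fitzpatrick function.
-/

namespace VMFB

/-! ### Minty's theorem through the Fitzpatrick function. -/

/-- A continuous uniformly midpoint-convex function plus the height coordinate attains its infimum
on a closed midpoint-convex set. -/
theorem exists_minimizer_add_height {E : Type*} [NormedAddCommGroup E] [NormedSpace ℝ E]
    [CompleteSpace E] (q : E → ℝ) (hq : Continuous q) {c : ℝ} (hc : 0 < c)
    (hmid : ∀ z w, q ((1 / 2 : ℝ) • (z + w)) ≤ (q z + q w) / 2 - c * ‖z - w‖ ^ 2)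
    (C : Set (E × ℝ)) (hC : IsClosed C) (hne : C.Nonempty)
    (hconv : ∀ p ∈ C, ∀ r ∈ C, ((1 / 2 : ℝ) • (p + r)) ∈ C)
    (hbdd : ∀ p ∈ C, 0 ≤ p.2 + q p.1) :
    ∃ p ∈ C, ∀ r ∈ C, p.2 + q p.1 ≤ r.2 + q r.1 := by
  set f : E × ℝ → ℝ := fun p => p.2 + q p.1 with hf
  have hfc : Continuous f := by fun_prop
  set m := sInf (f '' C) with hm
  have hb : BddBelow (f '' C) := ⟨0, by rintro _ ⟨p, hp, rfl⟩; exact hbdd p hp⟩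
  have hmle : ∀ p ∈ C, m ≤ f p := fun p hp => csInf_le hb ⟨p, hp, rfl⟩
  have hex : ∀ n : ℕ, ∃ p ∈ C, f p < m + 1 / ((n : ℝ) + 1) := by
    intro n
    have : m < m + 1 / ((n : ℝ) + 1) := by
      have : (0 : ℝ) < 1 / ((n : ℝ) + 1) := by positivity
      linarith
    obtain ⟨_, ⟨p, hp, rfl⟩, h⟩ := exists_lt_of_csInf_lt (hne.image f) this
    exact ⟨p, hp, h⟩
  choose p hpC hpf using hex
  have hlim : Tendsto (fun n : ℕ => 1 / ((n : ℝ) + 1)) atTop (𝓝 0) :=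
    tendsto_one_div_add_atTop_nhds_zero_nat
  -- The midpoint of two near-minimisers is in `C` and cannot go below `m`, so `hmid` forces their
  -- first coordinates together.
  have hcau : CauchySeq fun n => (p n).1 := by
    refine cauchySeq_of_le_tendsto_0 (fun n : ℕ => √((1 / ((n : ℝ) + 1)) / c)) ?_ ?_
    · intro n k N hn hk
      rw [dist_eq_norm]
      apply Real.le_sqrt_of_sq_le
      rw [le_div_iff₀ hc]
      have h1 := hmle _ (hconv _ (hpC n) _ (hpC k))
      have h2 := hmid (p n).1 (p k).1
      have h3 : f ((1 / 2 : ℝ) • (p n + p k)) =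
          (1 / 2) * ((p n).2 + (p k).2) + q ((1 / 2 : ℝ) • ((p n).1 + (p k).1)) := by
        simp [hf]; ring
      have h4 := hpf n
      have h5 := hpf k
      have h6 : 1 / ((n : ℝ) + 1) ≤ 1 / ((N : ℝ) + 1) := by gcongr
      have h7 : 1 / ((k : ℝ) + 1) ≤ 1 / ((N : ℝ) + 1) := by gcongr
      simp only [hf] at h4 h5
      rw [h3] at h1
      nlinarith
    · have := (hlim.div_const c).sqrt
      simpa using this
  obtain ⟨z, hz⟩ := cauchySeq_tendsto_of_complete hcau
  have hfm : Tendsto (fun n => f (p n)) atTop (𝓝 m) := by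
    refine tendsto_of_tendsto_of_tendsto_of_le_of_le tendsto_const_nhds
      (h := fun n : ℕ => m + 1 / ((n : ℝ) + 1)) ?_ (fun n => hmle _ (hpC n))
      (fun n => (hpf n).le)
    simpa using hlim.const_add m
  have hqz : Tendsto (fun n => q (p n).1) atTop (𝓝 (q z)) := (hq.tendsto z).comp hz
  have ht : Tendsto (fun n => (p n).2) atTop (𝓝 (m - q z)) := by
    have := hfm.sub hqz
    simpa [hf] using this
  have hp : Tendsto p atTop (𝓝 (z, m - q z)) := hz.prodMk_nhds ht
  refine ⟨(z, m - q z), hC.mem_of_tendsto hp (Eventually.of_forall hpC), fun r hr => ?_⟩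
  simpa using hmle r hr

/-- First-order condition along a segment: divide by `s` and let `s` tend to 0. The proof uses one
small `s` at which `a + s * |b|` would still be negative. -/
theorem nonneg_of_forall_mul_add_sq_mul_nonneg {a b : ℝ}
    (h : ∀ s : ℝ, 0 < s → s ≤ 1 → 0 ≤ s * a + s ^ 2 * b) : 0 ≤ a := by
  by_contra ha
  push Not at ha
  have hb : 0 < |b| + 1 - a := by have := abs_nonneg b; linarith
  have hs : 0 < -a / (|b| + 1 - a) := div_pos (by linarith) hb
  have hs1 : -a / (|b| + 1 - a) ≤ 1 := by
    rw [div_le_one hb]; have := abs_nonneg b; linarith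
  have h1 := h _ hs hs1
  set s := -a / (|b| + 1 - a) with hsd
  have h2 : s * (|b| + 1 - a) = -a := by rw [hsd]; field_simp
  have h3 : 0 ≤ s * (a + s * b) := by nlinarith
  have h4 : 0 ≤ a + s * b := nonneg_of_mul_nonneg_right h3 hs
  have h5 : s * b ≤ s * |b| := by gcongr; exact le_abs_self b
  nlinarith

variable {H : Type*} [NormedAddCommGroup H] [InnerProductSpace ℝ H]

/-- Minty's theorem in variable metric form, for a maximal monotone graph. -/
theorem exists_neg_map_mem_of_maximal_monotone [CompleteSpace H] (G : Set (H × H))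
    (hmono : ∀ p ∈ G, ∀ r ∈ G, 0 ≤ ⟪p.1 - r.1, p.2 - r.2⟫_ℝ)
    (hmax : ∀ x u : H, (∀ r ∈ G, 0 ≤ ⟪x - r.1, u - r.2⟫_ℝ) → (x, u) ∈ G)
    (U W : H →L[ℝ] H) (hUW : ∀ x, U (W x) = x)
    (hU : ∀ x y, ⟪U x, y⟫_ℝ = ⟪x, U y⟫_ℝ) (hW : ∀ x y, ⟪W x, y⟫_ℝ = ⟪x, W y⟫_ℝ)
    {c : ℝ} (hc : 0 < c) (hcU : ∀ x, c * ‖x‖ ^ 2 ≤ ⟪U x, x⟫_ℝ)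
    (hcW : ∀ x, c * ‖x‖ ^ 2 ≤ ⟪W x, x⟫_ℝ) :
    ∃ u, (-U u, u) ∈ G := by
  have hne : G.Nonempty := by
    by_contra hG
    rw [Set.not_nonempty_iff_eq_empty] at hG
    have := hmax 0 0 (by simp [hG])
    simp [hG] at this
  -- Epigraph of the Fitzpatrick function of `G`, closed and convex as an intersection of
  -- half-spaces.
  set C : Set ((H × H) × ℝ) :=
    {p | ∀ r ∈ G, ⟪r.1, p.1.2⟫_ℝ + ⟪p.1.1, r.2⟫_ℝ - ⟪r.1, r.2⟫_ℝ ≤ p.2} with hCdef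
  set q : H × H → ℝ := fun z => (⟪W z.1, z.1⟫_ℝ + ⟪U z.2, z.2⟫_ℝ) / 2 with hq
  have hGC : ∀ r ∈ G, ((r.1, r.2), ⟪r.1, r.2⟫_ℝ) ∈ C := by
    intro r hr s hs
    have := hmono r hr s hs
    simp only [inner_sub_left, inner_sub_right] at this
    simp only
    linarith
  -- If the height fell below the pairing, the point would be monotonically related to `G`, hence in
  -- `G` by maximality, and its own constraint would be violated.
  have hCge : ∀ p ∈ C, ⟪p.1.1, p.1.2⟫_ℝ ≤ p.2 := by
    intro p hp
    by_contra hlt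
    push Not at hlt
    have hpG : (p.1.1, p.1.2) ∈ G := by
      refine hmax _ _ fun r hr => ?_
      have := hp r hr
      simp only [inner_sub_left, inner_sub_right]
      linarith
    have := hp _ hpG
    simp only at this
    linarith
  -- Completing the square: with `hCge`, the objective is at least `⟪U (W x + u), W x + u⟫ / 2`, so
  -- it is nonnegative.
  have hsq : ∀ x u : H, (⟪W x, x⟫_ℝ + ⟪U u, u⟫_ℝ) / 2 + ⟪x, u⟫_ℝ
      = ⟪U (W x + u), W x + u⟫_ℝ / 2 := by
    intro x u
    have h1 : ⟪U u, W x⟫_ℝ = ⟪x, u⟫_ℝ := by rw [hU, hUW, real_inner_comm]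
    simp only [map_add, inner_add_left, inner_add_right, hUW, h1]
    rw [real_inner_comm x (W x)]
    ring
  have hUnn : ∀ x, 0 ≤ ⟪U x, x⟫_ℝ := fun x => le_trans (by positivity) (hcU x)
  have hCcl : IsClosed C := by
    rw [hCdef, Set.ofPred_forall]
    refine isClosed_iInter fun r => ?_
    rw [Set.ofPred_forall]
    refine isClosed_iInter fun hr => isClosed_le (by fun_prop) (by fun_prop)
  have hCseg : ∀ p ∈ C, ∀ r ∈ C, ∀ s t : ℝ, 0 ≤ s → 0 ≤ t → s + t = 1 →
      (s • p + t • r) ∈ C := by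
    intro p hp r hr s t hs ht hst g hg
    have h1 := mul_le_mul_of_nonneg_left (hp g hg) hs
    have h2 := mul_le_mul_of_nonneg_left (hr g hg) ht
    simp only [Prod.fst_add, Prod.snd_add, Prod.smul_fst, Prod.smul_snd, inner_add_left,
      inner_add_right, inner_smul_left, inner_smul_right, conj_trivial, smul_eq_mul]
    have h3 : ⟪g.1, g.2⟫_ℝ = s * ⟪g.1, g.2⟫_ℝ + t * ⟪g.1, g.2⟫_ℝ := by
      rw [← add_mul, hst, one_mul]
    linarith
  obtain ⟨⟨⟨x, u⟩, t⟩, hpC, hmin⟩ := exists_minimizer_add_height q (by fun_prop)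
    (c := c / 8) (by positivity) (by
      rintro ⟨x, u⟩ ⟨x', u'⟩
      have e1 : ∀ (V : H →L[ℝ] H) (a b : H), (∀ x y, ⟪V x, y⟫_ℝ = ⟪x, V y⟫_ℝ) →
          ⟪V ((1 / 2 : ℝ) • (a + b)), (1 / 2 : ℝ) • (a + b)⟫_ℝ =
          (⟪V a, a⟫_ℝ + ⟪V b, b⟫_ℝ) / 2 - ⟪V (a - b), a - b⟫_ℝ / 4 := by
        intro V a b hV
        simp only [map_smul, map_add, map_sub, inner_smul_left, inner_smul_right, inner_add_left,
          inner_add_right, inner_sub_left, inner_sub_right, conj_trivial]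
        ring
      have hx := hcW (x - x')
      have hu := hcU (u - u')
      have hn : ‖((x, u) : H × H) - (x', u')‖ ^ 2 ≤ ‖x - x'‖ ^ 2 + ‖u - u'‖ ^ 2 := by
        rw [Prod.mk_sub_mk, Prod.norm_mk]
        rcases max_cases ‖x - x'‖ ‖u - u'‖ with ⟨h, _⟩ | ⟨h, _⟩ <;> rw [h] <;>
          nlinarith [sq_nonneg ‖x - x'‖, sq_nonneg ‖u - u'‖]
      simp only [hq, Prod.mk_add_mk, Prod.smul_mk]
      rw [e1 W x x' hW, e1 U u u' hU]
      nlinarith)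
    C hCcl ⟨_, hGC _ hne.some_mem⟩
    (fun p hp r hr => by
      rw [smul_add]; exact hCseg p hp r hr _ _ (by norm_num) (by norm_num) (by norm_num))
    (fun p hp => by
      have h1 := hCge p hp
      have h2 := hsq p.1.1 p.1.2
      have h3 := hUnn (W p.1.1 + p.1.2)
      simp only [hq]
      linarith)
  -- Move from the minimiser towards a graph point lifted to height `⟪r.1, r.2⟫`.
  have hopt : ∀ r ∈ G, 0 ≤ ⟪r.1, r.2⟫_ℝ - t + (⟪W x, r.1 - x⟫_ℝ + ⟪U u, r.2 - u⟫_ℝ) := by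
    intro r hr
    refine nonneg_of_forall_mul_add_sq_mul_nonneg (b := q (r - (x, u))) fun s hs hs1 => ?_
    have h1 := hmin _ (hCseg _ hpC _ (hGC r hr) (1 - s) s (by linarith) hs.le (by ring))
    simp only [hq, Prod.fst_add, Prod.snd_add, Prod.smul_fst, Prod.smul_snd, Prod.fst_sub,
      Prod.snd_sub, smul_eq_mul] at h1 ⊢
    have e1 : ∀ (V : H →L[ℝ] H) (a b : H), (∀ x y, ⟪V x, y⟫_ℝ = ⟪x, V y⟫_ℝ) →
          ⟪V ((1 - s) • a + s • b), (1 - s) • a + s • b⟫_ℝ =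
          ⟪V a, a⟫_ℝ + 2 * s * ⟪V a, b - a⟫_ℝ + s ^ 2 * ⟪V (b - a), b - a⟫_ℝ := by
      intro V a b hV
      have : ⟪V b, a⟫_ℝ = ⟪V a, b⟫_ℝ := by rw [hV, real_inner_comm]
      simp only [map_smul, map_add, map_sub, inner_smul_left, inner_smul_right, inner_add_left,
          inner_add_right, inner_sub_left, inner_sub_right, conj_trivial, this]
      ring
    rw [e1 W x _ hW, e1 U u _ hU] at h1
    linarith
  have htx := hCge _ hpC
  have hrel : ∀ r ∈ G, ⟪U (W x + u), W x + u⟫_ℝ ≤ ⟪-U u - r.1, -W x - r.2⟫_ℝ := by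
    intro r hr
    have h1 := hopt r hr
    have h2 := hsq x u
    have h3 : ⟪U u, W x⟫_ℝ = ⟪x, u⟫_ℝ := by rw [hU, hUW, real_inner_comm]
    have h4 : ⟪r.1, W x⟫_ℝ = ⟪W x, r.1⟫_ℝ := real_inner_comm _ _
    simp only [inner_sub_left, inner_sub_right, inner_neg_left, inner_neg_right] at h1 ⊢
    simp only at htx
    linarith
  -- Optimality makes this point monotonically related to `G`. Testing `hrel` at the point itself
  -- then forces `W x + u = 0`.
  have hmem : (-U u, -W x) ∈ G := hmax _ _ fun r hr => (hUnn _).trans (hrel r hr)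
  have h0 : W x + u = 0 := by
    have h1 := hrel _ hmem
    simp only [sub_self, inner_zero_left] at h1
    have h2 := hcU (W x + u)
    have h3 : ‖W x + u‖ ^ 2 = 0 := le_antisymm (by nlinarith) (by positivity)
    simpa using h3
  refine ⟨u, ?_⟩
  rwa [neg_eq_of_add_eq_zero_right h0] at hmem

/-- Adjoining the single pair `(x, u)` to the graph keeps it monotone, so maximality says the pair
was already there. -/
theorem IsMaximalMonotone.mem_of_forall {A : H → Set H} (hA : IsMaximalMonotone A) {x u : H}
    (h : ∀ y, ∀ v ∈ A y, 0 ≤ ⟪x - y, u - v⟫_ℝ) : u ∈ A x := by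
  have key := hA.2 (fun y => A y ∪ {v | y = x ∧ v = u}) ?_ (fun y => Set.subset_union_left)
  · rw [← key]; exact Or.inr ⟨rfl, rfl⟩
  · rintro y z v (hv | ⟨rfl, rfl⟩) w (hw | ⟨rfl, rfl⟩)
    · exact hA.1 y z v hv w hw
    · have := h y v hv
      rw [← neg_sub, ← neg_sub w v, inner_neg_neg] ; exact this
    · exact h z w hw
    · simp

/-- Surjectivity of `I + U A`, from the previous theorem applied to the graph of `A` translated by
`y`. -/
theorem exists_mem_sub_map [CompleteSpace H] {A : H → Set H} (hA : IsMaximalMonotone A)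
    (U W : H →L[ℝ] H) (hUW : ∀ x, U (W x) = x)
    (hU : ∀ x y, ⟪U x, y⟫_ℝ = ⟪x, U y⟫_ℝ) (hW : ∀ x y, ⟪W x, y⟫_ℝ = ⟪x, W y⟫_ℝ)
    {c : ℝ} (hc : 0 < c) (hcU : ∀ x, c * ‖x‖ ^ 2 ≤ ⟪U x, x⟫_ℝ)
    (hcW : ∀ x, c * ‖x‖ ^ 2 ≤ ⟪W x, x⟫_ℝ) (y : H) :
    ∃ u, u ∈ A (y - U u) := by
  obtain ⟨u, hu⟩ := exists_neg_map_mem_of_maximal_monotone {p : H × H | p.2 ∈ A (p.1 + y)}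
    (fun p hp r hr => by simpa using hA.1 _ _ _ hp _ hr)
    (fun x u h => hA.mem_of_forall fun z v hv => by
      have := h (z - y, v) (by simpa using hv)
      rwa [show x + y - z = x - (z - y) by abel])
    U W hUW hU hW hc hcU hcW
  exact ⟨u, by simpa [sub_eq_neg_add] using hu⟩

/-! ### Quadratic forms and variable metrics. -/

variable {H : Type*} [NormedAddCommGroup H] [InnerProductSpace ℝ H]

theorem quadratic_sub_smul {V : H →L[ℝ] H} (hV : ∀ x y, ⟪V x, y⟫_ℝ = ⟪x, V y⟫_ℝ) (x y : H)
    (s : ℝ) : ⟪V (x - s • y), x - s • y⟫_ℝ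
      = ⟪V x, x⟫_ℝ - 2 * s * ⟪V x, y⟫_ℝ + s ^ 2 * ⟪V y, y⟫_ℝ := by
  have h : ⟪V y, x⟫_ℝ = ⟪V x, y⟫_ℝ := by rw [hV, real_inner_comm]
  simp only [map_sub, map_smul, inner_sub_left, inner_sub_right, inner_smul_left,
    inner_smul_right, conj_trivial, h]
  ring

theorem quadratic_add {V : H →L[ℝ] H} (hV : ∀ x y, ⟪V x, y⟫_ℝ = ⟪x, V y⟫_ℝ) (x y : H) :
    ⟪V (x + y), x + y⟫_ℝ = ⟪V x, x⟫_ℝ + 2 * ⟪V x, y⟫_ℝ + ⟪V y, y⟫_ℝ := by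
  have h : ⟪V y, x⟫_ℝ = ⟪V x, y⟫_ℝ := by rw [hV, real_inner_comm]
  simp only [map_add, inner_add_left, inner_add_right, h]
  ring

theorem quadratic_sub {V : H →L[ℝ] H} (hV : ∀ x y, ⟪V x, y⟫_ℝ = ⟪x, V y⟫_ℝ) (x y : H) :
    ⟪V (x - y), x - y⟫_ℝ = ⟪V x, x⟫_ℝ - 2 * ⟪V x, y⟫_ℝ + ⟪V y, y⟫_ℝ := by
  simpa using quadratic_sub_smul hV x y 1

/-- Cauchy–Schwarz for a positive semidefinite operator. -/
theorem inner_map_sq_le {V : H →L[ℝ] H} (hV : ∀ x y, ⟪V x, y⟫_ℝ = ⟪x, V y⟫_ℝ)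
    (hV0 : ∀ x, 0 ≤ ⟪V x, x⟫_ℝ) (x y : H) :
    ⟪V x, y⟫_ℝ ^ 2 ≤ ⟪V x, x⟫_ℝ * ⟪V y, y⟫_ℝ := by
  have h : ∀ s : ℝ, 0 ≤ ⟪V y, y⟫_ℝ * (s * s) + (-2 * ⟪V x, y⟫_ℝ) * s + ⟪V x, x⟫_ℝ := fun s => by
    have h1 := hV0 (x - s • y)
    rw [quadratic_sub_smul hV] at h1
    linarith
  have := discrim_le_zero h
  rw [discrim] at this
  linarith

theorem metricNorm_nonneg (V : H →L[ℝ] H) (x : H) : 0 ≤ metricNorm V x := Real.sqrt_nonneg _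

theorem metricNorm_sq {V : H →L[ℝ] H} (hV0 : ∀ x, 0 ≤ ⟪V x, x⟫_ℝ) (x : H) :
    metricNorm V x ^ 2 = ⟪V x, x⟫_ℝ := Real.sq_sqrt (hV0 x)

theorem inner_map_le_metricNorm_mul {V : H →L[ℝ] H} (hV : ∀ x y, ⟪V x, y⟫_ℝ = ⟪x, V y⟫_ℝ)
    (hV0 : ∀ x, 0 ≤ ⟪V x, x⟫_ℝ) (x y : H) :
    |⟪V x, y⟫_ℝ| ≤ metricNorm V x * metricNorm V y := by
  apply abs_le_of_sq_le_sq _ (mul_nonneg (metricNorm_nonneg _ _) (metricNorm_nonneg _ _))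
  rw [mul_pow, metricNorm_sq hV0, metricNorm_sq hV0]
  exact inner_map_sq_le hV hV0 x y

theorem metricNorm_add_le {V : H →L[ℝ] H} (hV : ∀ x y, ⟪V x, y⟫_ℝ = ⟪x, V y⟫_ℝ)
    (hV0 : ∀ x, 0 ≤ ⟪V x, x⟫_ℝ) (x y : H) :
    metricNorm V (x + y) ≤ metricNorm V x + metricNorm V y := by
  rw [← pow_le_pow_iff_left₀ (metricNorm_nonneg _ _)
    (add_nonneg (metricNorm_nonneg _ _) (metricNorm_nonneg _ _)) two_ne_zero]
  rw [metricNorm_sq hV0, quadratic_add hV, add_sq, metricNorm_sq hV0, metricNorm_sq hV0]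
  have := (abs_le.1 (inner_map_le_metricNorm_mul hV hV0 x y)).2
  linarith

theorem metricNorm_smul (V : H →L[ℝ] H) (s : ℝ) (x : H) :
    metricNorm V (s • x) = |s| * metricNorm V x := by
  rw [metricNorm, metricNorm, ← Real.sqrt_sq_eq_abs, ← Real.sqrt_mul (sq_nonneg s)]
  congr 1
  simp only [map_smul, inner_smul_left, inner_smul_right, conj_trivial]
  ring

/-- `W` is the inverse of the symmetric operator `U`, and `α ‖x‖² ≤ ⟨U x, x⟩`. -/
structure IsMetricPair (α : ℝ) (U W : H →L[ℝ] H) : Prop where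
  pos : 0 < α
  right_inv : ∀ x, U (W x) = x
  left_inv : ∀ x, W (U x) = x
  symm : ∀ x y, ⟪U x, y⟫_ℝ = ⟪x, U y⟫_ℝ
  coercive : ∀ x, α * ‖x‖ ^ 2 ≤ ⟪U x, x⟫_ℝ

theorem isMetricPair_inverse [CompleteSpace H] {α : ℝ} (hα : 0 < α) {U : H →L[ℝ] H}
    (hU : U ∈ strongPos α) : IsMetricPair α U U.inverse where
  pos := hα
  right_inv := (inverse_of_mem_strongPos hα hU).1
  left_inv := (inverse_of_mem_strongPos hα hU).2
  symm := fun x y => hU.1.isSymmetric x y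
  coercive := fun x => by
    have h := ((ContinuousLinearMap.le_def _ _).1 hU.2).2 x
    rw [ContinuousLinearMap.reApplyInnerSelf_apply] at h
    simp only [sub_apply, smul_apply, one_apply_eq_self, inner_sub_left, inner_smul_left,
      real_inner_self_eq_norm_sq, RCLike.re_to_real, conj_trivial] at h
    linarith

namespace IsMetricPair

variable {α : ℝ} {U W : H →L[ℝ] H}

theorem nonneg (h : IsMetricPair α U W) (x : H) : 0 ≤ ⟪U x, x⟫_ℝ :=
  le_trans (by have := h.pos; positivity) (h.coercive x)

theorem symm_inv (h : IsMetricPair α U W) (x y : H) : ⟪W x, y⟫_ℝ = ⟪x, W y⟫_ℝ := by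
  conv_lhs => rw [← h.right_inv y, ← h.symm, h.right_inv]

theorem nonneg_inv (h : IsMetricPair α U W) (x : H) : 0 ≤ ⟪W x, x⟫_ℝ := by
  have := h.nonneg (W x)
  rwa [h.right_inv, real_inner_comm] at this

theorem norm_inv_le (h : IsMetricPair α U W) (x : H) : α * ‖W x‖ ≤ ‖x‖ := by
  have h1 := h.coercive (W x)
  rw [h.right_inv] at h1
  have h2 := real_inner_le_norm x (W x)
  rcases (norm_nonneg (W x)).eq_or_lt with h0 | h0
  · rw [← h0]; simp
  · nlinarith

theorem inner_inv_le (h : IsMetricPair α U W) (x : H) : α * ⟪W x, x⟫_ℝ ≤ ‖x‖ ^ 2 := by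
  have h1 := h.norm_inv_le x
  have h2 := real_inner_le_norm (W x) x
  have h3 := h.pos
  nlinarith [norm_nonneg x]

theorem metricNorm_inv_le (h : IsMetricPair α U W) (x : H) :
    metricNorm W x ≤ ‖x‖ / √α := by
  rw [metricNorm, ← Real.sqrt_sq (norm_nonneg x), ← Real.sqrt_div (by positivity)]
  apply Real.sqrt_le_sqrt
  rw [le_div_iff₀ h.pos]
  linarith [h.inner_inv_le x]

/-- `x ↦ ⟨U⁻¹ x, x⟩` is antitone in `U`. -/
theorem inner_inv_le_of_le {U' W' : H →L[ℝ] H} {α' c : ℝ} (h : IsMetricPair α U W)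
    (h' : IsMetricPair α' U' W') (hc : 0 < c) (hle : ∀ x, ⟪U x, x⟫_ℝ ≤ c * ⟪U' x, x⟫_ℝ) (x : H) :
    ⟪W' x, x⟫_ℝ ≤ c * ⟪W x, x⟫_ℝ := by
  -- Expanding this form produces `⟪W x, x⟫ - (2 / c) * ⟪W' x, x⟫` plus a term that `hle` bounds by
  -- `(1 / c) * ⟪W' x, x⟫`.
  have h1 := h.nonneg (W x - (1 / c) • W' x)
  rw [quadratic_sub_smul h.symm, h.right_inv] at h1
  have h2 := hle (W' x)
  rw [h'.right_inv] at h2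
  have e : ⟪x, W x⟫_ℝ = ⟪W x, x⟫_ℝ := real_inner_comm _ _
  have e' : ⟪x, W' x⟫_ℝ = ⟪W' x, x⟫_ℝ := real_inner_comm _ _
  rw [e] at h1
  rw [e'] at h1 h2
  have h3 : (1 / c) ^ 2 * ⟪U (W' x), W' x⟫_ℝ ≤ (1 / c) ^ 2 * (c * ⟪W' x, x⟫_ℝ) := by gcongr
  have h4 : (1 / c) ^ 2 * (c * ⟪W' x, x⟫_ℝ) = (1 / c) * ⟪W' x, x⟫_ℝ := by field_simp
  have h5 : 0 ≤ ⟪W x, x⟫_ℝ - (1 / c) * ⟪W' x, x⟫_ℝ := by linarith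
  have h6 := mul_nonneg hc.le h5
  have h7 : c * (⟪W x, x⟫_ℝ - (1 / c) * ⟪W' x, x⟫_ℝ) = c * ⟪W x, x⟫_ℝ - ⟪W' x, x⟫_ℝ := by
    field_simp
  linarith

theorem sq_norm_le (h : IsMetricPair α U W) {m : ℝ} (hm : 0 < m) (hU : ‖U‖ ≤ m) (x : H) :
    ‖x‖ ^ 2 ≤ m * ⟪W x, x⟫_ℝ := by
  have h1 : IsMetricPair 1 (1 : H →L[ℝ] H) 1 :=
    ⟨one_pos, by simp, by simp, by simp, by simp⟩
  have := h.inner_inv_le_of_le h1 hm (fun x => by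
    have h2 := real_inner_le_norm (U x) x
    have h3 := U.le_of_opNorm_le hU x
    simp only [one_apply_eq_self, real_inner_self_eq_norm_sq]
    nlinarith [norm_nonneg x]) x
  simpa using this

theorem norm_le_metricNorm (h : IsMetricPair α U W) {m : ℝ} (hm : 0 < m) (hU : ‖U‖ ≤ m) (x : H) :
    ‖x‖ ≤ √m * metricNorm W x := by
  rw [metricNorm, ← Real.sqrt_mul hm.le]
  exact Real.le_sqrt_of_sq_le (h.sq_norm_le hm hU x)

end IsMetricPair

/-! ### Perturbed monotone sequences. -/

/-- A nonnegative sequence that is nonincreasing up to summable relative and absolute errors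
converges. -/
theorem exists_tendsto_of_le_one_add_mul {u η e : ℕ → ℝ} (hu : ∀ n, 0 ≤ u n) (hη : ∀ n, 0 ≤ η n)
    (he : ∀ n, 0 ≤ e n) (hηs : Summable η) (hes : Summable e)
    (h : ∀ n, u (n + 1) ≤ (1 + η n) * (u n + e n)) : ∃ l, Tendsto u atTop (𝓝 l) := by
  set P : ℕ → ℝ := fun n => ∏ j ∈ Finset.range n, (1 + η j) with hP
  have hPs : ∀ n, P (n + 1) = P n * (1 + η n) := fun n => Finset.prod_range_succ _ _
  have hP1 : ∀ n, 1 ≤ P n := fun n => by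
    induction n with
    | zero => simp [hP]
    | succ n ih => rw [hPs]; nlinarith [hη n]
  have hPmono : Monotone P := monotone_nat_of_le_succ fun n => by
    rw [hPs]; nlinarith [hη n, hP1 n]
  have hPb : BddAbove (Set.range P) := by
    refine ⟨Real.exp (∑' j, η j), ?_⟩
    rintro _ ⟨n, rfl⟩
    calc P n ≤ ∏ j ∈ Finset.range n, Real.exp (η j) :=
          Finset.prod_le_prod (fun j _ => by linarith [hη j])
            (fun j _ => by linarith [Real.add_one_le_exp (η j)])
      _ = Real.exp (∑ j ∈ Finset.range n, η j) := (Real.exp_sum _ _).symm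
      _ ≤ _ := Real.exp_le_exp.2 (hηs.sum_le_tsum _ fun j _ => hη j)
  have hPlim := tendsto_atTop_ciSup hPmono hPb
  -- Dividing by the bounded products absorbs the relative errors, and subtracting the partial sums
  -- absorbs the absolute ones, leaving an antitone sequence.
  set w : ℕ → ℝ := fun n => u n / P n - ∑ j ∈ Finset.range n, e j with hw
  have hwanti : Antitone w := antitone_nat_of_succ_le fun n => by
    simp only [hw, Finset.sum_range_succ]
    have hpos : 0 < P n := by linarith [hP1 n]
    have h1 : u (n + 1) / P (n + 1) ≤ (u n + e n) / P n := by
      rw [hPs, div_le_div_iff₀ (by have := hη n; positivity) hpos]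
      nlinarith [h n]
    have h2 : e n / P n ≤ e n := div_le_self (he n) (hP1 n)
    rw [add_div] at h1
    linarith
  have hwb : BddBelow (Set.range w) := by
    refine ⟨-∑' j, e j, ?_⟩
    rintro _ ⟨n, rfl⟩
    have h1 : 0 ≤ u n / P n := div_nonneg (hu n) (by linarith [hP1 n])
    have h2 := hes.sum_le_tsum (Finset.range n) fun j _ => he j
    simp only [hw]
    linarith
  have hwlim := tendsto_atTop_ciInf hwanti hwb
  refine ⟨_, (((hwlim.add hes.hasSum.tendsto_sum_nat).mul hPlim).congr fun n => ?_)⟩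
  have hpos : P n ≠ 0 := by linarith [hP1 n]
  simp only [hw]
  field_simp
  ring

/-! ### Pointwise summable families of operators. -/

section SummableFamily

variable {H : Type*} [NormedAddCommGroup H] [InnerProductSpace ℝ H] [CompleteSpace H]

/-- Uniform boundedness principle for the seminorms `∑ k ∈ s, ‖D k ·‖`, indexed by finite sets `s`.
-/
theorem exists_sum_norm_le_of_summable (D : ℕ → H →L[ℝ] H)
    (hD : ∀ x, Summable fun k => ‖D k x‖) :
    ∃ C : ℝ, 0 < C ∧ ∀ (s : Finset ℕ) (x : H), ∑ k ∈ s, ‖D k x‖ ≤ C * ‖x‖ := by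
  let p : Finset ℕ → Seminorm ℝ H := fun s =>
    ∑ k ∈ s, (normSeminorm ℝ H).comp (D k : H →ₗ[ℝ] H)
  have hp : ∀ s x, p s x = ∑ k ∈ s, ‖D k x‖ := fun s x => by
    classical
    induction s using Finset.induction_on with
    | empty => simp [p]
    | insert a s ha ih =>
      simp only [p, Finset.sum_insert ha] at ih ⊢
      rw [add_apply, ih]
      rfl
  have hbdd : BddAbove (Set.range p) := by
    rw [Seminorm.bddAbove_range_iff]
    refine fun x => ⟨∑' k, ‖D k x‖, ?_⟩
    rintro _ ⟨s, rfl⟩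
    simp only [hp]
    exact (hD x).sum_le_tsum s fun k _ => norm_nonneg _
  have hcont : Continuous (⨆ s, p s : Seminorm ℝ H) := by
    rw [Seminorm.coe_iSup_eq hbdd]
    refine Seminorm.continuous_iSup p (fun s => ?_) hbdd
    have : (p s : H → ℝ) = fun x => ∑ k ∈ s, ‖D k x‖ := funext (hp s)
    rw [this]
    fun_prop
  obtain ⟨C, hC, hCb⟩ := Seminorm.bound_of_continuous_normedSpace _ hcont
  refine ⟨C, hC, fun s x => ?_⟩
  rw [← hp]
  exact ((le_ciSup hbdd s : p s ≤ ⨆ s, p s) x).trans (hCb x)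

/-- In a Hilbert space, pointwise absolute summability of a sequence of operators makes the
`ℓ¹`-operator norms of far blocks small. -/
theorem exists_forall_sum_norm_le_of_summable (D : ℕ → H →L[ℝ] H)
    (hD : ∀ x, Summable fun k => ‖D k x‖) {ε : ℝ} (hε : 0 < ε) :
    ∃ N : ℕ, ∀ s : Finset ℕ, (∀ k ∈ s, N ≤ k) → ∀ x, ∑ k ∈ s, ‖D k x‖ ≤ ε * ‖x‖ := by
  obtain ⟨C, hC, hCb⟩ := exists_sum_norm_le_of_summable D hD
  by_contra hcon
  push Not at hcon
  have hunit : ∀ N : ℕ, ∃ s : Finset ℕ, (∀ k ∈ s, N ≤ k) ∧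
      ∃ x : H, ‖x‖ = 1 ∧ ε < ∑ k ∈ s, ‖D k x‖ := by
    intro N
    obtain ⟨s, hs, x, hx⟩ := hcon N
    have hx0 : 0 < ‖x‖ := by
      rw [norm_pos_iff]
      rintro rfl
      simp at hx
    refine ⟨s, hs, ‖x‖⁻¹ • x, ?_, ?_⟩
    · rw [norm_smul, norm_inv, norm_norm, inv_mul_cancel₀ hx0.ne']
    · simp only [map_smul, norm_smul, norm_inv, norm_norm]
      rw [← Finset.mul_sum, ← div_eq_inv_mul, lt_div_iff₀ hx0]
      exact hx
  -- Gliding hump with signs. Add or subtract a bad unit vector from a later block: averaged over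
  -- both signs the sums do not decrease and the new block gains more than `ε`, while by the
  -- parallelogram law `‖Y‖²` grows by exactly 1. With weight `2 / ε` the net gain is at least 1 for
  -- one of the signs.
  have hstep : ∀ n : ℕ, ∃ (N : ℕ) (S : Finset ℕ) (Y : H), (∀ k ∈ S, k < N) ∧
      (n : ℝ) ≤ 2 / ε * ∑ k ∈ S, ‖D k Y‖ - ‖Y‖ ^ 2 := by
    intro n
    induction n with
    | zero => exact ⟨0, ∅, 0, by simp, by simp⟩
    | succ n ih =>
      obtain ⟨N, S, Y, hS, hY⟩ := ih
      obtain ⟨s, hs, x, hx1, hx⟩ := hunit N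
      have hdisj : Disjoint S s := Finset.disjoint_left.2 fun k hk hk' =>
        absurd (hS k hk) (not_lt.2 (hs k hk'))
      have hN' : ∀ k ∈ S ∪ s, k < max N (s.sup id + 1) := by
        intro k hk
        rcases Finset.mem_union.1 hk with hk | hk
        · exact lt_max_of_lt_left (hS k hk)
        · exact lt_max_of_lt_right (Nat.lt_succ_of_le (Finset.le_sup (f := id) hk))
      have h1 : ∀ k, 2 * ‖D k Y‖ ≤ ‖D k (Y + x)‖ + ‖D k (Y - x)‖ := fun k => by
        have := norm_add_le (D k (Y + x)) (D k (Y - x))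
        rwa [← map_add, show Y + x + (Y - x) = (2 : ℝ) • Y by rw [two_smul]; abel, map_smul,
          norm_smul, Real.norm_two] at this
      have h2 : ∀ k, 2 * ‖D k x‖ ≤ ‖D k (Y + x)‖ + ‖D k (Y - x)‖ := fun k => by
        have := norm_sub_le (D k (Y + x)) (D k (Y - x))
        rwa [← map_sub, show Y + x - (Y - x) = (2 : ℝ) • x by rw [two_smul]; abel, map_smul,
          norm_smul, Real.norm_two] at this
      have h3 := Finset.sum_le_sum fun k (_ : k ∈ S) => h1 k
      have h4 := Finset.sum_le_sum fun k (_ : k ∈ s) => h2 k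
      rw [← Finset.mul_sum, Finset.sum_add_distrib] at h3 h4
      have h5 := parallelogram_law_with_norm ℝ Y x
      have h6 : 2 / ε * ε = 2 := by field_simp
      have h7 : 0 < 2 / ε := by positivity
      have key : 2 * ((n : ℝ) + 1) ≤
          (2 / ε * ∑ k ∈ S ∪ s, ‖D k (Y + x)‖ - ‖Y + x‖ ^ 2) +
          (2 / ε * ∑ k ∈ S ∪ s, ‖D k (Y - x)‖ - ‖Y - x‖ ^ 2) := by
        rw [Finset.sum_union hdisj, Finset.sum_union hdisj]
        rw [hx1] at h5
        have h8 := mul_le_mul_of_nonneg_left h3 h7.le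
        have h9 := mul_le_mul_of_nonneg_left h4 h7.le
        have h10 := mul_le_mul_of_nonneg_left hx.le h7.le
        nlinarith
      push_cast
      rcases le_total ((n : ℝ) + 1) (2 / ε * ∑ k ∈ S ∪ s, ‖D k (Y + x)‖ - ‖Y + x‖ ^ 2) with h | h
      · exact ⟨_, _, Y + x, hN', h⟩
      · exact ⟨_, _, Y - x, hN', by linarith⟩
  -- The uniform bound `C` caps the functional at `2 (C/ε) ‖Y‖ - ‖Y‖² ≤ (C/ε)²`.
  obtain ⟨n, hn⟩ := exists_nat_gt ((C / ε) ^ 2)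
  obtain ⟨N, S, Y, -, hY⟩ := hstep n
  have h1 := mul_le_mul_of_nonneg_left (hCb S Y) (by positivity : 0 ≤ 2 / ε)
  have h2 : 2 / ε * (C * ‖Y‖) = 2 * (C / ε) * ‖Y‖ := by ring
  nlinarith [sq_nonneg (C / ε - ‖Y‖)]

end SummableFamily

/-! ### Estimates for the forward-backward residual. -/

theorem le_four_mul_sq_of_sq_le {p N R S : ℝ} (h : p ^ 2 ≤ R ^ 2 * N) (hN : 0 ≤ N)
    (hpN : N ≤ 2 * p) (hS : S ≤ 2 * p) : S ≤ 4 * R ^ 2 := by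
  have h1 : p * p ≤ (2 * R ^ 2) * p := by
    have : R ^ 2 * N ≤ R ^ 2 * (2 * p) := by gcongr
    nlinarith
  rcases (by linarith : 0 ≤ p).eq_or_lt with h0 | h0
  · have := sq_nonneg R
    linarith
  · have := le_of_mul_le_mul_right h1 h0
    linarith

/-- Cauchy–Schwarz makes `c` of order `R√S`, and `S ≤ 4R²` makes `S` itself of order `R√S`; squaring
gives the bound. -/
theorem sq_le_of_le_sub_two_mul {κ N S R c : ℝ} (hκ0 : 0 ≤ κ) (hκ1 : κ < 1) (hN : 0 ≤ N)
    (hS : 0 ≤ S) (hR : 0 ≤ R) (hSR : S ≤ 4 * R ^ 2)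
    (h : κ * (1 - κ) * N ≤ (1 - κ) * S - 2 * c) (hc : c ^ 2 ≤ R ^ 2 * S) :
    (κ * (1 - κ) * N) ^ 2 ≤ 16 * R ^ 2 * S := by
  have hYS := Real.sq_sqrt hS
  have hY0 := Real.sqrt_nonneg S
  have hY2 : √S ≤ 2 * R := Real.sqrt_le_iff.2 ⟨by positivity, by linarith⟩
  have hcs : |c| ≤ R * √S := by
    apply abs_le_of_sq_le_sq _ (by positivity)
    rw [mul_pow, hYS]
    exact hc
  have h1 := (abs_le.1 hcs).1
  have h2 : (1 - κ) * S ≤ 1 * S := by gcongr; linarith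
  have h3 : √S * √S ≤ 2 * R * √S := by gcongr
  have h4 : κ * (1 - κ) * N ≤ 4 * R * √S := by linarith
  have hnn : 0 ≤ κ * (1 - κ) * N := mul_nonneg (mul_nonneg hκ0 (by linarith)) hN
  calc _ ≤ (4 * R * √S) ^ 2 := pow_le_pow_left₀ hnn h4 2
    _ = 16 * R ^ 2 * S := by rw [mul_pow, hYS]; ring

theorem neg_mem_of_mem_zer {H : Type*} [NormedAddCommGroup H] {A : H → Set H} {B : H → H}
    {x : H} (hx : x ∈ zer (addSingle A B)) : -B x ∈ A x := by
  obtain ⟨u, hu, h0⟩ := hx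
  rwa [neg_eq_of_add_eq_zero_left h0.symm]

theorem mem_zer_of_neg_mem {H : Type*} [NormedAddCommGroup H] {A : H → Set H} {B : H → H}
    {x : H} (hx : -B x ∈ A x) : x ∈ zer (addSingle A B) :=
  ⟨-B x, hx, by simp⟩

section ForwardBackward

variable {H : Type*} [NormedAddCommGroup H] [InnerProductSpace ℝ H]
  {α β γ κ R : ℝ} {U W : H →L[ℝ] H}

theorem inner_sq_le_opNorm (h : IsMetricPair α U W) (v d : H) :
    ⟪v, d⟫_ℝ ^ 2 ≤ ⟪W v, v⟫_ℝ * (‖U‖ * ‖d‖ ^ 2) := by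
  have h1 := inner_map_sq_le h.symm_inv h.nonneg_inv v (U d)
  rw [h.symm_inv v (U d), h.left_inv] at h1
  refine h1.trans (mul_le_mul_of_nonneg_left ?_ (h.nonneg_inv v))
  have h2 := real_inner_le_norm d (U d)
  have h3 := U.le_opNorm d
  nlinarith [norm_nonneg d]

theorem two_mul_inner_ge (h : IsMetricPair α U W) {z v d : H}
    (hzv : 0 ≤ ⟪z - v, W v - γ • d⟫_ℝ) :
    κ * ⟪W v, v⟫_ℝ + 2 * γ * ⟪z, d⟫_ℝ - 2 * γ * ⟪v, d⟫_ℝ ≤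
      2 * ⟪W z, v⟫_ℝ - (2 - κ) * ⟪W v, v⟫_ℝ := by
  simp only [inner_sub_left, inner_sub_right, inner_smul_right] at hzv
  rw [← h.symm_inv z v, ← h.symm_inv v v] at hzv
  linarith

/-- Averagedness: `2γ⟪v, d⟫` is split by the arithmetic-geometric mean inequality into `κ⟪W v, v⟫`,
already available, and `2γβ‖d‖²`, paid for by cocoercivity. -/
theorem residual_gap_nonneg (h : IsMetricPair α U W) {z v d : H} (hβ : 0 < β) (hγ : 0 < γ)
    (hκ : γ * ‖U‖ = 2 * β * κ) (hzd : β * ‖d‖ ^ 2 ≤ ⟪z, d⟫_ℝ)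
    (hzv : 0 ≤ ⟪z - v, W v - γ • d⟫_ℝ) :
    0 ≤ 2 * ⟪W z, v⟫_ℝ - (2 - κ) * ⟪W v, v⟫_ℝ := by
  refine le_trans ?_ (two_mul_inner_ge (κ := κ) h hzv)
  have hκ0 : 0 ≤ κ := by
    have : 0 ≤ 2 * β * κ := hκ ▸ by positivity
    exact nonneg_of_mul_nonneg_right this (by positivity)
  have hN := h.nonneg_inv v
  have h1 : |2 * γ * ⟪v, d⟫_ℝ| ≤ κ * ⟪W v, v⟫_ℝ + 2 * γ * (β * ‖d‖ ^ 2) := by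
    apply abs_le_of_sq_le_sq _ (by positivity)
    have h2 := inner_sq_le_opNorm h v d
    have h3 : (2 * γ * ⟪v, d⟫_ℝ) ^ 2 ≤ 4 * γ ^ 2 * (⟪W v, v⟫_ℝ * (‖U‖ * ‖d‖ ^ 2)) := by
      rw [mul_pow]
      have : (2 * γ) ^ 2 = 4 * γ ^ 2 := by ring
      rw [this]
      gcongr
    have h4 : 4 * γ ^ 2 * (⟪W v, v⟫_ℝ * (‖U‖ * ‖d‖ ^ 2)) =
        4 * γ * ⟪W v, v⟫_ℝ * ‖d‖ ^ 2 * (γ * ‖U‖) := by ring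
    rw [h4, hκ] at h3
    nlinarith [sq_nonneg (κ * ⟪W v, v⟫_ℝ - 2 * γ * (β * ‖d‖ ^ 2))]
  have h5 := (abs_le.1 h1).2
  have h6 : 2 * γ * (β * ‖d‖ ^ 2) ≤ 2 * γ * ⟪z, d⟫_ℝ := by gcongr
  linarith

/-- The forward-backward residual `v` satisfies, besides averagedness, a quartic coercivity
estimate. -/
theorem residual_sq_le_gap (h : IsMetricPair α U W) {z v d : H} (hβ : 0 < β) (hγ : 0 < γ)
    (hκ : γ * ‖U‖ = 2 * β * κ) (hκ1 : κ < 1) (hzd : β * ‖d‖ ^ 2 ≤ ⟪z, d⟫_ℝ)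
    (hzv : 0 ≤ ⟪z - v, W v - γ • d⟫_ℝ) (hR : metricNorm W z ≤ R) :
    (κ * (1 - κ) * ⟪W v, v⟫_ℝ) ^ 2 ≤
      16 * R ^ 2 * (2 * ⟪W z, v⟫_ℝ - (2 - κ) * ⟪W v, v⟫_ℝ) := by
  have hS0 := residual_gap_nonneg h hβ hγ hκ hzd hzv
  have hS1 := two_mul_inner_ge (κ := κ) h hzv
  have hκ0 : 0 ≤ κ := by
    have : 0 ≤ 2 * β * κ := hκ ▸ by positivity
    exact nonneg_of_mul_nonneg_right this (by positivity)
  have hN := h.nonneg_inv v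
  have hR0 : 0 ≤ R := (metricNorm_nonneg _ _).trans hR
  set S := 2 * ⟪W z, v⟫_ℝ - (2 - κ) * ⟪W v, v⟫_ℝ with hS
  -- `g` is the defect in the equality case of averagedness. Its squared `W`-norm is at most `κ S`,
  -- so a small gap forces `γ U d` close to `κ v`.
  set g := γ • U d - κ • v with hg
  have hWg : W g = γ • d - κ • W v := by
    rw [hg, map_sub, map_smul, map_smul, h.left_inv]
  have hgg : ⟪W g, g⟫_ℝ ≤ κ * S := by
    have e1 : ⟪W g, g⟫_ℝ =
        γ ^ 2 * ⟪U d, d⟫_ℝ - 2 * κ * γ * ⟪v, d⟫_ℝ + κ ^ 2 * ⟪W v, v⟫_ℝ := by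
      rw [hWg, hg]
      simp only [inner_sub_left, inner_sub_right, inner_smul_left, inner_smul_right, conj_trivial]
      rw [h.symm_inv v (U d), h.left_inv, real_inner_comm v d, real_inner_comm (U d) d]
      ring
    have e2 : ⟪U d, d⟫_ℝ ≤ ‖U‖ * ‖d‖ ^ 2 := by
      have h2 := real_inner_le_norm (U d) d
      have h3 := U.le_opNorm d
      nlinarith [norm_nonneg d]
    have e3 : γ ^ 2 * ⟪U d, d⟫_ℝ ≤ γ ^ 2 * (‖U‖ * ‖d‖ ^ 2) := by gcongr
    have e4 : γ ^ 2 * (‖U‖ * ‖d‖ ^ 2) = 2 * κ * γ * (β * ‖d‖ ^ 2) := by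
      calc _ = γ * (γ * ‖U‖) * ‖d‖ ^ 2 := by ring
        _ = _ := by rw [hκ]; ring
    have e5 : 2 * κ * γ * (β * ‖d‖ ^ 2) ≤ 2 * κ * γ * ⟪z, d⟫_ℝ := by gcongr
    have e6 := mul_le_mul_of_nonneg_left hS1 hκ0
    rw [e1]
    linarith
  have hcross : ⟪W (z - v), g⟫_ℝ = γ * ⟪z - v, d⟫_ℝ - κ * (⟪W z, v⟫_ℝ - ⟪W v, v⟫_ℝ) := by
    rw [h.symm_inv, hWg, inner_sub_right, inner_smul_right, inner_smul_right, ← h.symm_inv,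
      map_sub, inner_sub_left (W z)]
  -- Replacing `γ U d` by `κ v + g` in the monotonicity inequality leaves `κ(1 - κ)⟪W v, v⟫` bounded
  -- by the gap and a cross term with `g`.
  have hmain : κ * (1 - κ) * ⟪W v, v⟫_ℝ ≤ (1 - κ) * S - 2 * ⟪W (z - v), g⟫_ℝ := by
    rw [hcross, inner_sub_left]
    have : κ * S = 2 * κ * ⟪W z, v⟫_ℝ - κ * (2 - κ) * ⟪W v, v⟫_ℝ := by rw [hS]; ring
    linarith
  have hz2 : ⟪W z, z⟫_ℝ ≤ R ^ 2 := by
    rw [← metricNorm_sq h.nonneg_inv]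
    exact pow_le_pow_left₀ (metricNorm_nonneg _ _) hR 2
  have hκN : 0 ≤ (1 - κ) * ⟪W v, v⟫_ℝ := mul_nonneg (by linarith) hN
  -- The form at `z - v` equals `⟪W z, z⟫ - S - (1 - κ)⟪W v, v⟫`.
  have hzv2 : ⟪W (z - v), z - v⟫_ℝ ≤ R ^ 2 := by
    rw [quadratic_sub h.symm_inv]
    linarith
  have hS4 : S ≤ 4 * R ^ 2 := by
    have h1 := inner_map_sq_le h.symm_inv h.nonneg_inv z v
    have h2 : ⟪W z, v⟫_ℝ ^ 2 ≤ R ^ 2 * ⟪W v, v⟫_ℝ := h1.trans (by gcongr)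
    have h3 : S = 2 * ⟪W z, v⟫_ℝ - ⟪W v, v⟫_ℝ - (1 - κ) * ⟪W v, v⟫_ℝ := by rw [hS]; ring
    exact le_four_mul_sq_of_sq_le h2 hN (by linarith) (by linarith)
  have hcs : ⟪W (z - v), g⟫_ℝ ^ 2 ≤ R ^ 2 * S := by
    have h1 := inner_map_sq_le h.symm_inv h.nonneg_inv (z - v) g
    have h2 : κ * S ≤ 1 * S := by gcongr
    have h3 := h.nonneg_inv g
    refine h1.trans (mul_le_mul hzv2 (by linarith) h3 (by positivity))
  exact sq_le_of_le_sub_two_mul hκ0 hκ1 hN hS0 hR0 hS4 hmain hcs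

variable {A : H → Set H} {B : H → H}

theorem IsCocoercive.norm_sub_le (hB : IsCocoercive β B) (x y : H) :
    β * ‖B x - B y‖ ≤ ‖x - y‖ := by
  have h1 := hB x y
  have h2 := real_inner_le_norm (x - y) (B x - B y)
  rcases (norm_nonneg (B x - B y)).eq_or_lt with h0 | h0
  · rw [← h0]; simp
  · nlinarith

variable [CompleteSpace H]

/-- Minty's theorem makes the choice in `resolvent` a genuine one, and the inclusion is then solved
for the element of `A`. -/
theorem smul_map_sub_resolvent_mem (hA : IsMaximalMonotone A) (h : IsMetricPair α U W)
    (hγ : 0 < γ) (y : H) :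
    γ⁻¹ • W (y - resolvent (scaledOp γ U A) y) ∈ A (resolvent (scaledOp γ U A) y) := by
  have hm : 0 < ‖U‖ + 1 := by positivity
  have hα := h.pos
  obtain ⟨u, hu⟩ := exists_mem_sub_map hA (γ • U) (γ⁻¹ • W)
    (fun x => by simp [h.right_inv, smul_smul, hγ.ne'])
    (fun x y => by simp [inner_smul_left, inner_smul_right, h.symm])
    (fun x y => by simp [inner_smul_left, inner_smul_right, h.symm_inv])
    (c := min (γ * α) (γ⁻¹ * (‖U‖ + 1)⁻¹)) (by positivity)
    (fun x => by
      have h1 := h.coercive x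
      calc _ ≤ (γ * α) * ‖x‖ ^ 2 := by gcongr; exact min_le_left _ _
        _ = γ * (α * ‖x‖ ^ 2) := by ring
        _ ≤ γ * ⟪U x, x⟫_ℝ := by gcongr
        _ = _ := by simp [inner_smul_left])
    (fun x => by
      have h1 := h.sq_norm_le hm (by linarith) x
      have h2 : (‖U‖ + 1)⁻¹ * ‖x‖ ^ 2 ≤ ⟪W x, x⟫_ℝ := by
        rw [inv_mul_le_iff₀ hm]; exact h1
      calc _ ≤ (γ⁻¹ * (‖U‖ + 1)⁻¹) * ‖x‖ ^ 2 := by gcongr; exact min_le_right _ _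
        _ = γ⁻¹ * ((‖U‖ + 1)⁻¹ * ‖x‖ ^ 2) := by ring
        _ ≤ γ⁻¹ * ⟪W x, x⟫_ℝ := by gcongr
        _ = _ := by simp [inner_smul_left]) y
  have hex : ∃ p, p ∈ invIdAdd (scaledOp γ U A) y :=
    ⟨_, _, ⟨u, hu, rfl⟩, by simp⟩
  obtain ⟨w, ⟨u', hu', rfl⟩, hy⟩ := Classical.epsilon_spec hex
  change u' ∈ A (resolvent (scaledOp γ U A) y) at hu'
  change y = resolvent (scaledOp γ U A) y + γ • U u' at hy
  have : y - resolvent (scaledOp γ U A) y = γ • U u' := sub_eq_of_eq_add' hy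
  rw [this, map_smul, h.left_inv, smul_smul, inv_mul_cancel₀ hγ.ne', one_smul]
  exact hu'

/-- Monotonicity of `A` becomes firm nonexpansiveness in the metric `W`, since `γ U A` is monotone
for that inner product. -/
theorem metricNorm_resolvent_sub_le (hA : IsMaximalMonotone A) (h : IsMetricPair α U W)
    (hγ : 0 < γ) (y y' : H) :
    metricNorm W (resolvent (scaledOp γ U A) y - resolvent (scaledOp γ U A) y') ≤
      metricNorm W (y - y') := by
  have h1 := hA.1 _ _ _ (smul_map_sub_resolvent_mem hA h hγ y) _
    (smul_map_sub_resolvent_mem hA h hγ y')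
  set p := resolvent (scaledOp γ U A) y
  set p' := resolvent (scaledOp γ U A) y'
  rw [← smul_sub, inner_smul_right, ← map_sub,
    show y - p - (y' - p') = (y - y') - (p - p') by abel, map_sub, inner_sub_right,
    ← h.symm_inv, ← h.symm_inv] at h1
  have h2 := nonneg_of_mul_nonneg_right h1 (inv_pos.2 hγ)
  have h3 := (abs_le.1 (inner_map_le_metricNorm_mul h.symm_inv h.nonneg_inv (p - p') (y - y'))).2
  have h4 := metricNorm_sq h.nonneg_inv (p - p')
  rcases (metricNorm_nonneg W (p - p')).eq_or_lt with h0 | h0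
  · rw [← h0]; exact metricNorm_nonneg _ _
  · exact le_of_mul_le_mul_left (by nlinarith) h0

theorem smul_map_residual_sub_mem (hA : IsMaximalMonotone A) (h : IsMetricPair α U W)
    (hγ : 0 < γ) (x : H) :
    γ⁻¹ • W (x - fbOp A B γ U x) - B x ∈ A (fbOp A B γ U x) := by
  have h1 := smul_map_sub_resolvent_mem hA h hγ (x - γ • U (B x))
  change γ⁻¹ • W (x - γ • U (B x) - fbOp A B γ U x) ∈ A (fbOp A B γ U x) at h1
  rwa [sub_right_comm, map_sub, map_smul, h.left_inv, smul_sub, smul_smul,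
    inv_mul_cancel₀ hγ.ne', one_smul] at h1

theorem inner_residual_nonneg (hA : IsMaximalMonotone A) (h : IsMetricPair α U W)
    (hγ : 0 < γ) (x : H) {xs : H} (hxs : xs ∈ zer (addSingle A B)) :
    0 ≤ ⟪x - xs - (x - fbOp A B γ U x), W (x - fbOp A B γ U x) - γ • (B x - B xs)⟫_ℝ := by
  have h1 := hA.1 _ _ _ (smul_map_residual_sub_mem (B := B) hA h hγ x) _ (neg_mem_of_mem_zer hxs)
  have h2 := mul_nonneg hγ.le h1
  rw [← inner_smul_right] at h2
  have e : γ • (γ⁻¹ • W (x - fbOp A B γ U x) - B x - -B xs) =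
      W (x - fbOp A B γ U x) - γ • (B x - B xs) := by
    rw [sub_neg_eq_add, sub_add, smul_sub, smul_smul, mul_inv_cancel₀ hγ.ne', one_smul]
  rw [e] at h2
  rwa [show x - xs - (x - fbOp A B γ U x) = fbOp A B γ U x - xs by abel]

/-- The forward-backward residual is Lipschitz. -/
theorem norm_residual_sub_le (hA : IsMaximalMonotone A) (hB : IsCocoercive β B)
    (h : IsMetricPair α U W) (hγ : 0 < γ) (hγU : γ * ‖U‖ ≤ 2 * β) {m : ℝ} (hm : 0 < m)
    (hU : ‖U‖ ≤ m) (x y : H) :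
    ‖(x - fbOp A B γ U x) - (y - fbOp A B γ U y)‖ ≤ (1 + √m / √α * 3) * ‖x - y‖ := by
  -- The factor 3 is `1 + 2`, from `γ‖U‖ ≤ 2β` and the `1/β`-Lipschitz bound on `B`; `√m / √α` in
  -- the conclusion is the cost of changing norms.
  have h1 : ‖(x - γ • U (B x)) - (y - γ • U (B y))‖ ≤ 3 * ‖x - y‖ := by
    have e : (x - γ • U (B x)) - (y - γ • U (B y)) = (x - y) - γ • U (B x - B y) := by
      rw [map_sub, smul_sub]; abel
    rw [e]
    have h2 : ‖γ • U (B x - B y)‖ ≤ 2 * ‖x - y‖ := by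
      rw [norm_smul, Real.norm_of_nonneg hγ.le]
      calc γ * ‖U (B x - B y)‖ ≤ γ * (‖U‖ * ‖B x - B y‖) := by gcongr; exact U.le_opNorm _
        _ = (γ * ‖U‖) * ‖B x - B y‖ := by ring
        _ ≤ (2 * β) * ‖B x - B y‖ := by gcongr
        _ = 2 * (β * ‖B x - B y‖) := by ring
        _ ≤ _ := by gcongr; exact hB.norm_sub_le x y
    linarith [norm_sub_le (x - y) (γ • U (B x - B y))]
  have h2 : ‖fbOp A B γ U x - fbOp A B γ U y‖ ≤ √m / √α * 3 * ‖x - y‖ := by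
    calc _ ≤ √m * metricNorm W (fbOp A B γ U x - fbOp A B γ U y) :=
          h.norm_le_metricNorm hm hU _
      _ ≤ √m * metricNorm W ((x - γ • U (B x)) - (y - γ • U (B y))) := by
          gcongr; exact metricNorm_resolvent_sub_le hA h hγ _ _
      _ ≤ √m * (‖(x - γ • U (B x)) - (y - γ • U (B y))‖ / √α) := by
          gcongr; exact h.metricNorm_inv_le _
      _ ≤ √m * (3 * ‖x - y‖ / √α) := by gcongr
      _ = _ := by ring
  have e : (x - fbOp A B γ U x) - (y - fbOp A B γ U y) =
      (x - y) - (fbOp A B γ U x - fbOp A B γ U y) := by abel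
  rw [e]
  linarith [norm_sub_le (x - y) (fbOp A B γ U x - fbOp A B γ U y)]

/-- Dependence of the forward-backward residual on the step size and the metric. -/
theorem norm_residual_change_le (hA : IsMaximalMonotone A) (h : IsMetricPair α U W)
    {α' γ' : ℝ} {U' W' : H →L[ℝ] H} (h' : IsMetricPair α' U' W') (hγ : 0 < γ) (hγ' : 0 < γ')
    {m : ℝ} (hm : 0 < m) (hU' : ‖U'‖ ≤ m) (x : H) :
    ‖(x - fbOp A B γ' U' x) - (x - fbOp A B γ U x)‖ ≤
      m * (|γ' - γ| / γ * (‖x - fbOp A B γ U x‖ / α) +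
        ‖W (x - fbOp A B γ U x) - W' (x - fbOp A B γ U x)‖) := by
  -- Both inclusions are taken at the same `x`, so `B x` cancels and only the changes of `γ` and `W`
  -- remain.
  have h1 := hA.1 _ _ _ (smul_map_residual_sub_mem (B := B) hA h hγ x) _
    (smul_map_residual_sub_mem (B := B) hA h' hγ' x)
  set p := fbOp A B γ U x
  set p' := fbOp A B γ' U' x
  set v := x - p with hv
  set δ := x - p' - v with hδ
  have e1 : p - p' = δ := by rw [hδ, hv]; abel
  have e2 : x - p' = v + δ := by rw [hδ]; abel
  rw [e1, e2, map_add] at h1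
  have h2 := mul_nonneg hγ'.le h1
  rw [← inner_smul_right] at h2
  have e3 : γ' • (γ⁻¹ • W v - B x - (γ'⁻¹ • (W' v + W' δ) - B x)) =
      ((γ' - γ) / γ) • W v + (W v - W' v) - W' δ := by
    rw [sub_sub_sub_cancel_right, smul_sub, smul_smul, smul_smul, mul_inv_cancel₀ hγ'.ne', one_smul,
      sub_div, div_self hγ.ne', sub_smul, one_smul, div_eq_mul_inv]
    abel
  rw [e3, inner_sub_right] at h2
  have h3 := h'.sq_norm_le hm hU' δ
  have h4 := real_inner_le_norm δ (((γ' - γ) / γ) • W v + (W v - W' v))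
  have h5 := norm_add_le (((γ' - γ) / γ) • W v) (W v - W' v)
  rw [norm_smul, Real.norm_eq_abs, abs_div, abs_of_pos hγ] at h5
  have h6 : ‖W v‖ ≤ ‖v‖ / α := by
    rw [le_div_iff₀ h.pos, mul_comm]; exact h.norm_inv_le v
  have h7 : |γ' - γ| / γ * ‖W v‖ ≤ |γ' - γ| / γ * (‖v‖ / α) := by gcongr
  set X := |γ' - γ| / γ * (‖v‖ / α) + ‖W v - W' v‖ with hX
  have h8 : ‖((γ' - γ) / γ) • W v + (W v - W' v)‖ ≤ X := by linarith
  rw [h'.symm_inv] at h3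
  have h9 : ⟪δ, W' δ⟫_ℝ ≤ ‖δ‖ * X :=
    (by linarith : _ ≤ _).trans (h4.trans (mul_le_mul_of_nonneg_left h8 (norm_nonneg _)))
  have h10 : ‖δ‖ ^ 2 ≤ m * (‖δ‖ * X) := h3.trans (mul_le_mul_of_nonneg_left h9 hm.le)
  rcases (norm_nonneg δ).eq_or_lt with h0 | h0
  · rw [← h0]
    have := h.pos
    positivity
  · have : ‖δ‖ * ‖δ‖ ≤ ‖δ‖ * (m * X) := by nlinarith
    exact le_of_mul_le_mul_left this h0

end ForwardBackward

/-! ### Quasi-Fejér sequences with dissipation. -/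

theorem exists_forall_sum_le_of_summable {f : ℕ → ℝ} (hf : Summable f) {ε : ℝ} (hε : 0 < ε) :
    ∃ N : ℕ, ∀ s : Finset ℕ, (∀ k ∈ s, N ≤ k) → ∑ k ∈ s, f k ≤ ε := by
  obtain ⟨s, hs⟩ := summable_iff_vanishing_norm.1 hf ε hε
  refine ⟨s.sup id + 1, fun t ht => (Real.le_norm_self _).trans (hs t ?_).le⟩
  refine Finset.disjoint_left.2 fun k hk hk' => ?_
  have h1 := ht k hk
  have h2 : k ≤ s.sup id := Finset.le_sup (f := id) hk'
  omega

/-- Quasi-Fejér sequences with dissipation converge, and the dissipation is summable. -/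
theorem tendsto_and_summable_of_sq_le {q t δ η e : ℕ → ℝ} (hq : ∀ n, 0 ≤ q n) (ht : ∀ n, 0 ≤ t n)
    (hδ : ∀ n, 0 ≤ δ n) (hη : ∀ n, 0 ≤ η n) (he : ∀ n, 0 ≤ e n) (hηs : Summable η)
    (hes : Summable e) (h1 : ∀ n, t n ^ 2 ≤ q n ^ 2 - δ n)
    (h2 : ∀ n, q (n + 1) ^ 2 ≤ (1 + η n) * (t n + e n) ^ 2) :
    (∃ l, Tendsto q atTop (𝓝 l)) ∧ Summable δ := by
  have htq : ∀ n, t n ≤ q n := fun n =>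
    (pow_le_pow_iff_left₀ (ht n) (hq n) two_ne_zero).1 (by linarith [h1 n, hδ n])
  have hconv : ∃ l, Tendsto q atTop (𝓝 l) := by
    refine exists_tendsto_of_le_one_add_mul hq hη he hηs hes fun n => ?_
    have h3 : 0 ≤ q n + e n := add_nonneg (hq n) (he n)
    have h4 := hη n
    refine (pow_le_pow_iff_left₀ (hq _) (by positivity) two_ne_zero).1 ((h2 n).trans ?_)
    rw [mul_pow]
    have h5 : (t n + e n) ^ 2 ≤ (q n + e n) ^ 2 :=
      pow_le_pow_left₀ (add_nonneg (ht n) (he n)) (by linarith [htq n]) 2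
    have h6 : 1 + η n ≤ (1 + η n) ^ 2 := by nlinarith
    exact mul_le_mul h6 h5 (by positivity) (by positivity)
  refine ⟨hconv, ?_⟩
  obtain ⟨l, hl⟩ := hconv
  obtain ⟨Q, hQ⟩ := hl.bddAbove_range
  have hqQ : ∀ n, q n ≤ Q := fun n => hQ ⟨n, rfl⟩
  have hQ0 : 0 ≤ Q := (hq 0).trans (hqQ 0)
  set E := ∑' n, e n with hE
  have heE : ∀ n, e n ≤ E := fun n => hes.le_tsum n fun j _ => he j
  set r : ℕ → ℝ := fun n => (2 * Q + E) * e n + Q ^ 2 * η n with hr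
  have hrs : Summable r := (hes.mul_left _).add (hηs.mul_left _)
  have hr0 : ∀ n, 0 ≤ r n := fun n => by
    have := he n
    have := hη n
    have : 0 ≤ E := (he n).trans (heE n)
    positivity
  have hstep : ∀ n, δ n ≤ q n ^ 2 - q (n + 1) ^ 2 + r n := by
    intro n
    -- Since `(1 - η)(1 + η) ≤ 1`, the factor `1 + η` is moved to the left, where boundedness of `q`
    -- turns it into a summable term.
    have h3 : (1 - η n) * q (n + 1) ^ 2 ≤ (t n + e n) ^ 2 := by
      rcases le_total (η n) 1 with hle | hle
      · calc _ ≤ (1 - η n) * ((1 + η n) * (t n + e n) ^ 2) :=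
              mul_le_mul_of_nonneg_left (h2 n) (by linarith)
          _ = (1 - η n ^ 2) * (t n + e n) ^ 2 := by ring
          _ ≤ 1 * (t n + e n) ^ 2 := by gcongr; nlinarith [sq_nonneg (η n)]
          _ = _ := one_mul _
      · have : (1 - η n) * q (n + 1) ^ 2 ≤ 0 :=
          mul_nonpos_of_nonpos_of_nonneg (by linarith) (by positivity)
        exact this.trans (by positivity)
    have h4 : η n * q (n + 1) ^ 2 ≤ η n * Q ^ 2 :=
      mul_le_mul_of_nonneg_left (pow_le_pow_left₀ (hq _) (hqQ _) 2) (hη n)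
    have h5 : t n * e n ≤ Q * e n :=
      mul_le_mul_of_nonneg_right ((htq n).trans (hqQ n)) (he n)
    have h6 : e n * e n ≤ E * e n := mul_le_mul_of_nonneg_right (heE n) (he n)
    have h7 := h1 n
    simp only [hr]
    nlinarith
  refine summable_of_sum_range_le (c := q 0 ^ 2 + ∑' n, r n) hδ fun n => ?_
  calc ∑ i ∈ Finset.range n, δ i
      ≤ ∑ i ∈ Finset.range n, (q i ^ 2 - q (i + 1) ^ 2 + r i) :=
        Finset.sum_le_sum fun i _ => hstep i
    _ = q 0 ^ 2 - q n ^ 2 + ∑ i ∈ Finset.range n, r i := by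
        rw [Finset.sum_add_distrib, Finset.sum_range_sub' (fun i => q i ^ 2)]
    _ ≤ _ := by
        have := hrs.sum_le_tsum (Finset.range n) fun j _ => hr0 j
        have := sq_nonneg (q n)
        linarith

/-! ### Sequences of controlled variation. -/

section Residual

variable {H : Type*} [NormedAddCommGroup H] [InnerProductSpace ℝ H]

/-- The hypothesis concerns a fixed vector. Writing `v k` as `v N` plus increments and exchanging
sums applies it to each of these vectors in turn. -/
theorem sum_norm_apply_le_of_variation (D : ℕ → H →L[ℝ] H) (v : ℕ → H) {δ : ℝ} {N M : ℕ}
    (hD : ∀ x, ∑ k ∈ Finset.Ico N M, ‖D k x‖ ≤ δ * ‖x‖) :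
    ∑ k ∈ Finset.Ico N M, ‖D k (v k)‖ ≤
      δ * (‖v N‖ + ∑ j ∈ Finset.Ico N M, ‖v (j + 1) - v j‖) := by
  have h1 : ∀ k ∈ Finset.Ico N M, ‖D k (v k)‖ ≤
      ‖D k (v N)‖ + ∑ j ∈ Finset.Ico N M, ‖D k (v (j + 1) - v j)‖ := by
    intro k hk
    obtain ⟨hNk, hkM⟩ := Finset.mem_Ico.1 hk
    have e : v k = v N + ∑ j ∈ Finset.Ico N k, (v (j + 1) - v j) := by
      rw [Finset.sum_Ico_sub v hNk]; abel
    calc ‖D k (v k)‖ = ‖D k (v N) + ∑ j ∈ Finset.Ico N k, D k (v (j + 1) - v j)‖ := by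
          rw [← map_sum, ← map_add, ← e]
      _ ≤ ‖D k (v N)‖ + ∑ j ∈ Finset.Ico N k, ‖D k (v (j + 1) - v j)‖ :=
          (norm_add_le _ _).trans (by gcongr; exact norm_sum_le _ _)
      _ ≤ _ := by
          gcongr
  refine (Finset.sum_le_sum h1).trans ?_
  rw [Finset.sum_add_distrib, Finset.sum_comm, mul_add, Finset.mul_sum]
  exact add_le_add (hD _) (Finset.sum_le_sum fun j _ => hD _)

/-- A sequence whose increments are controlled by its own size, summable errors, and a pointwise
summable family of operators, and whose fourth powers are summable against divergent weights,
tends to zero. -/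
theorem tendsto_norm_zero_of_variation [CompleteSpace H] (D : ℕ → H →L[ℝ] H)
    (hD : ∀ x, Summable fun k => ‖D k x‖) (v : ℕ → H) {lam s : ℕ → ℝ} {C₁ C₂ L : ℝ}
    (hC₁ : 0 ≤ C₁) (hC₂ : 0 < C₂) (hlam : ∀ k, 0 ≤ lam k) (hL : ∀ k, lam k ≤ L)
    (hs : Summable s)
    (hv : ∀ k, ‖v (k + 1) - v k‖ ≤ C₁ * (lam k * ‖v k‖) + s k + C₂ * ‖D k (v k)‖)
    (hdiv : Tendsto (fun n => ∑ k ∈ Finset.range n, lam k) atTop atTop)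
    (hsum : Summable fun k => lam k * ‖v k‖ ^ 4) :
    Tendsto (fun k => ‖v k‖) atTop (𝓝 0) := by
  have hL0 : 0 ≤ L := (hlam 0).trans (hL 0)
  rw [Metric.tendsto_atTop]
  intro ε hε
  -- Chosen to dominate the final bound `‖v M‖ ≤ 2‖v N‖ + 2ρ + 2C₁(L + 1)ρ` with `‖v N‖ < ρ`.
  set K : ℝ := 5 + 2 * C₁ * (L + 1) with hK
  have hK0 : 0 < K := by positivity
  set ρ : ℝ := ε / K with hρ
  have hρ0 : 0 < ρ := by positivity
  -- With `1 / (2 * C₂)`, the operator term contributes half of the variation `V`, which moves to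
  -- the left side.
  obtain ⟨N₁, hN₁⟩ := exists_forall_sum_norm_le_of_summable D hD
    (show 0 < 1 / (2 * C₂) by positivity)
  obtain ⟨N₂, hN₂⟩ := exists_forall_sum_le_of_summable hs hρ0
  obtain ⟨N₃, hN₃⟩ := exists_forall_sum_le_of_summable hsum (show 0 < ρ ^ 4 by positivity)
  obtain ⟨N₀, hN₀, hvN₀⟩ : ∃ N, max N₁ (max N₂ N₃) ≤ N ∧ ‖v N‖ < ρ := by
    by_contra hcon
    push Not at hcon
    set N := max N₁ (max N₂ N₃)
    have hsl : Summable lam := by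
      rw [← summable_nat_add_iff N]
      refine Summable.of_nonneg_of_le (fun k => hlam _) (fun k => ?_)
        (((summable_nat_add_iff N).2 hsum).mul_left (1 / ρ ^ 4))
      have h1 := hcon (k + N) (by omega)
      have h2 : ρ ^ 4 ≤ ‖v (k + N)‖ ^ 4 := by gcongr
      rw [one_div, ← div_eq_inv_mul, le_div_iff₀ (by positivity)]
      exact mul_le_mul_of_nonneg_left h2 (hlam _)
    exact not_tendsto_nhds_of_tendsto_atTop hdiv _ hsl.hasSum.tendsto_sum_nat
  refine ⟨N₀, fun M hM => ?_⟩
  rw [Real.dist_0_eq_abs, abs_norm]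
  classical
  let P : ℕ → Prop := fun k => N₀ ≤ k ∧ ‖v k‖ < ρ
  -- Last time up to `M` at which `v` is below `ρ`; afterwards `‖v‖ ≥ ρ`, so `λ‖v‖ ≤ ρ⁻³ λ‖v‖⁴` is
  -- summably small.
  set N := Nat.findGreatest P M with hNdef
  have hPN : P N := Nat.findGreatest_spec hM (⟨le_rfl, hvN₀⟩ : P N₀)
  have hNM : N ≤ M := Nat.findGreatest_le M
  have hbig : ∀ k, N < k → k ≤ M → ρ ≤ ‖v k‖ := by
    intro k hk hkM
    have := Nat.findGreatest_is_greatest hk hkM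
    by_contra hlt
    push Not at hlt
    exact this ⟨hPN.1.trans hk.le, hlt⟩
  have hNge : max N₁ (max N₂ N₃) ≤ N := hN₀.trans hPN.1
  have hge : ∀ k ∈ Finset.Ico N M, N₁ ≤ k ∧ N₂ ≤ k ∧ N₃ ≤ k := by
    intro k hk
    have := (Finset.mem_Ico.1 hk).1
    omega
  set V := ∑ k ∈ Finset.Ico N M, ‖v (k + 1) - v k‖ with hV
  have hDV := sum_norm_apply_le_of_variation D v (N := N) (M := M)
    (hN₁ _ fun k hk => (hge k hk).1)
  have hsV := hN₂ _ fun k hk => (hge k hk).2.1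
  have hlamV : ∑ k ∈ Finset.Ico N M, lam k * ‖v k‖ ≤ (L + 1) * ρ := by
    rcases hNM.eq_or_lt with h | h
    · rw [h, Finset.Ico_self, Finset.sum_empty]
      positivity
    · rw [Finset.sum_eq_sum_Ico_succ_bot h, add_mul, one_mul]
      refine add_le_add (mul_le_mul (hL _) hPN.2.le (norm_nonneg _) hL0) ?_
      have h3 : ∀ k ∈ Finset.Ico (N + 1) M,
          lam k * ‖v k‖ ≤ 1 / ρ ^ 3 * (lam k * ‖v k‖ ^ 4) := by
        intro k hk
        obtain ⟨hk1, hk2⟩ := Finset.mem_Ico.1 hk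
        have h4 : ρ ^ 3 ≤ ‖v k‖ ^ 3 := pow_le_pow_left₀ hρ0.le (hbig k hk1 hk2.le) 3
        rw [one_div, ← div_eq_inv_mul, le_div_iff₀ (by positivity)]
        calc lam k * ‖v k‖ * ρ ^ 3 ≤ lam k * ‖v k‖ * ‖v k‖ ^ 3 :=
              mul_le_mul_of_nonneg_left h4 (mul_nonneg (hlam k) (norm_nonneg _))
          _ = _ := by ring
      refine (Finset.sum_le_sum h3).trans ?_
      rw [← Finset.mul_sum]
      have h5 := hN₃ (Finset.Ico (N + 1) M) fun k hk => by
        have := (Finset.mem_Ico.1 hk).1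
        omega
      calc _ ≤ 1 / ρ ^ 3 * ρ ^ 4 := by gcongr
        _ = ρ := by field_simp
  have hVle : V ≤ C₁ * ((L + 1) * ρ) + ρ + C₂ * (1 / (2 * C₂) * (‖v N‖ + V)) := by
    calc V ≤ ∑ k ∈ Finset.Ico N M, (C₁ * (lam k * ‖v k‖) + s k + C₂ * ‖D k (v k)‖) :=
          Finset.sum_le_sum fun k _ => hv k
      _ = C₁ * ∑ k ∈ Finset.Ico N M, lam k * ‖v k‖ + ∑ k ∈ Finset.Ico N M, s k +
          C₂ * ∑ k ∈ Finset.Ico N M, ‖D k (v k)‖ := by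
          rw [Finset.sum_add_distrib, Finset.sum_add_distrib, Finset.mul_sum, Finset.mul_sum]
      _ ≤ _ := by gcongr
  have e1 : C₂ * (1 / (2 * C₂) * (‖v N‖ + V)) = (‖v N‖ + V) / 2 := by field_simp
  have hvM : ‖v M‖ ≤ ‖v N‖ + V := by
    have e : v M = v N + ∑ j ∈ Finset.Ico N M, (v (j + 1) - v j) := by
      rw [Finset.sum_Ico_sub v hNM]; abel
    rw [e]
    exact (norm_add_le _ _).trans (by gcongr; exact norm_sum_le _ _)
  have hKρ : K * ρ = ε := by rw [hρ]; field_simp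
  have hvN := hPN.2
  rw [hK] at hKρ
  nlinarith

end Residual

/-! ### Weak limits and Opial's lemma. -/

section Weak

variable {H : Type*} [NormedAddCommGroup H] [InnerProductSpace ℝ H]

/-- Banach–Alaoglu on a closed ball of the dual, transported by the Riesz isometry. -/
theorem exists_weak_limit_ultrafilter [CompleteSpace H] {ι : Type*} {x : ι → H} {R : ℝ}
    (hR : ∀ k, ‖x k‖ ≤ R) (F : Ultrafilter ι) :
    ∃ z, ∀ y, Tendsto (fun k => ⟪x k, y⟫_ℝ) F (𝓝 ⟪z, y⟫_ℝ) := by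
  have hcomp := WeakDual.isCompact_closedBall (𝕜 := ℝ) (E := H) 0 R
  let f : ι → WeakDual ℝ H := fun k => StrongDual.toWeakDual (InnerProductSpace.toDual ℝ H (x k))
  have hf : ∀ k, f k ∈ WeakDual.toStrongDual ⁻¹' Metric.closedBall (0 : StrongDual ℝ H) R := by
    intro k
    simp only [Set.mem_preimage, mem_closedBall_zero_iff]
    change ‖InnerProductSpace.toDual ℝ H (x k)‖ ≤ R
    rw [LinearIsometryEquiv.norm_map]
    exact hR k
  obtain ⟨g, -, hg⟩ := hcomp.ultrafilter_le_nhds (F.map f)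
    (le_principal_iff.2 (Filter.mem_map.2 (Filter.univ_mem' hf)))
  refine ⟨(InnerProductSpace.toDual ℝ H).symm (WeakDual.toStrongDual g), fun y => ?_⟩
  rw [InnerProductSpace.toDual_symm_apply]
  have : Tendsto f F (𝓝 g) := hg
  exact ((WeakDual.eval_continuous y).tendsto g).comp this

theorem tendsto_inner_of_weak_of_strong {ι : Type*} {F : Filter ι} {p a : ι → H} {p₀ a₀ : H}
    {R : ℝ} (hR : ∀ k, ‖p k‖ ≤ R) (hp : ∀ y, Tendsto (fun k => ⟪p k, y⟫_ℝ) F (𝓝 ⟪p₀, y⟫_ℝ))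
    (ha : Tendsto a F (𝓝 a₀)) : Tendsto (fun k => ⟪p k, a k⟫_ℝ) F (𝓝 ⟪p₀, a₀⟫_ℝ) := by
  have h0 : Tendsto (fun k => ⟪p k, a k - a₀⟫_ℝ) F (𝓝 0) := by
    refine squeeze_zero_norm (a := fun k => R * ‖a k - a₀‖) (fun k => ?_) ?_
    · exact (norm_inner_le_norm _ _).trans (mul_le_mul_of_nonneg_right (hR k) (norm_nonneg _))
    · have := (ha.sub_const a₀).norm.const_mul R
      simpa using this
  refine (by simpa using h0.add (hp a₀) : Tendsto _ F (𝓝 ⟪p₀, a₀⟫_ℝ)).congr fun k => ?_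
  rw [inner_sub_right]; ring

theorem tendsto_toWeakSpace_iff [CompleteSpace H] {ι : Type*} {F : Filter ι} {x : ι → H} {z : H} :
    Tendsto (fun k => toWeakSpace ℝ H (x k)) F (𝓝 (toWeakSpace ℝ H z)) ↔
      ∀ y, Tendsto (fun k => ⟪x k, y⟫_ℝ) F (𝓝 ⟪z, y⟫_ℝ) := by
  have hinj : Function.Injective (topDualPairing ℝ H).flip := fun u w huw => by
    refine ext_inner_left ℝ fun y => ?_
    have := DFunLike.congr_fun huw (InnerProductSpace.toDual ℝ H y)
    simpa using this
  refine (WeakBilin.tendsto_iff_forall_eval_tendsto (topDualPairing ℝ H).flip hinj).trans ?_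
  constructor
  · intro h y
    have := h (InnerProductSpace.toDual ℝ H y)
    simp only [real_inner_comm y]
    exact this
  · intro h f
    have := h ((InnerProductSpace.toDual ℝ H).symm f)
    simp only [real_inner_comm ((InnerProductSpace.toDual ℝ H).symm f),
      InnerProductSpace.toDual_symm_apply] at this
    exact this

/-- Opial's lemma in a strongly convergent variable metric. -/
theorem exists_weak_limit_of_tendsto_metricNorm [CompleteSpace H] {x : ℕ → H} {R : ℝ}
    (hR : ∀ k, ‖x k‖ ≤ R) {W : ℕ → H →L[ℝ] H}
    (hWs : ∀ k x y, ⟪W k x, y⟫_ℝ = ⟪x, W k y⟫_ℝ) {c : ℝ} (hc : 0 < c)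
    (hWc : ∀ k x, c * ‖x‖ ^ 2 ≤ ⟪W k x, x⟫_ℝ)
    (hWlim : ∀ z, ∃ w, Tendsto (fun k => W k z) atTop (𝓝 w)) (Ω : Set H)
    (hΩ : ∀ z ∈ Ω, ∃ l, Tendsto (fun k => metricNorm (W k) (x k - z)) atTop (𝓝 l))
    (hcl : ∀ F : Ultrafilter ℕ, (F : Filter ℕ) ≤ atTop → ∀ z,
      (∀ y, Tendsto (fun k => ⟪x k, y⟫_ℝ) F (𝓝 ⟪z, y⟫_ℝ)) → z ∈ Ω) :
    ∃ z ∈ Ω, Tendsto (fun k => toWeakSpace ℝ H (x k)) atTop (𝓝 (toWeakSpace ℝ H z)) := by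
  have hW0 : ∀ k x, 0 ≤ ⟪W k x, x⟫_ℝ := fun k x => le_trans (by positivity) (hWc k x)
  have huniq : ∀ F G : Ultrafilter ℕ, (F : Filter ℕ) ≤ atTop → (G : Filter ℕ) ≤ atTop →
      ∀ z z', (∀ y, Tendsto (fun k => ⟪x k, y⟫_ℝ) F (𝓝 ⟪z, y⟫_ℝ)) →
      (∀ y, Tendsto (fun k => ⟪x k, y⟫_ℝ) G (𝓝 ⟪z', y⟫_ℝ)) → z = z' := by
    intro F G hF hG z z' hz hz'
    obtain ⟨l, hl⟩ := hΩ z (hcl F hF z hz)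
    obtain ⟨l', hl'⟩ := hΩ z' (hcl G hG z' hz')
    obtain ⟨w, hw⟩ := hWlim (z - z')
    obtain ⟨w₁, hw₁⟩ := hWlim z
    obtain ⟨w₂, hw₂⟩ := hWlim z'
    -- Polarisation: the difference of the two convergent squared distances is affine in `x k`. Both
    -- ultrafilters then yield the same limit, making `z - z'` orthogonal to `w = lim W k (z - z')`,
    -- against coercivity unless `z = z'`.
    obtain ⟨L, hL⟩ : ∃ L, Tendsto (fun k => ⟪x k, W k (z - z')⟫_ℝ) atTop (𝓝 L) := by
      have h1 := (((hl'.pow 2).sub (hl.pow 2)).add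
        ((hw₁.inner (tendsto_const_nhds (x := z))).sub
          (hw₂.inner (tendsto_const_nhds (x := z'))))).div_const 2
      refine ⟨_, h1.congr fun k => ?_⟩
      rw [metricNorm_sq (hW0 k), metricNorm_sq (hW0 k), quadratic_sub (hWs k),
        quadratic_sub (hWs k), map_sub, inner_sub_right, ← hWs, ← hWs]
      ring
    have h1 := tendsto_nhds_unique (tendsto_inner_of_weak_of_strong hR hz (hw.mono_left hF))
      (hL.mono_left hF)
    have h2 := tendsto_nhds_unique (tendsto_inner_of_weak_of_strong hR hz' (hw.mono_left hG))
      (hL.mono_left hG)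
    have h3 : ⟪w, z - z'⟫_ℝ = 0 := by
      rw [real_inner_comm, inner_sub_left, h1, h2, sub_self]
    have h4 : c * ‖z - z'‖ ^ 2 ≤ ⟪w, z - z'⟫_ℝ :=
      ge_of_tendsto' (hw.inner (tendsto_const_nhds (x := z - z'))) fun k => hWc k _
    have h5 : ‖z - z'‖ ^ 2 ≤ 0 := by
      by_contra hlt
      push Not at hlt
      have := mul_pos hc hlt
      linarith
    have h6 : ‖z - z'‖ = 0 := by
      have := le_antisymm h5 (by positivity)
      simpa using this
    exact sub_eq_zero.1 (norm_eq_zero.1 h6)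
  obtain ⟨z, hz⟩ := exists_weak_limit_ultrafilter hR (Ultrafilter.of (atTop : Filter ℕ))
  have hof := Ultrafilter.of_le (atTop : Filter ℕ)
  refine ⟨z, hcl _ hof z hz, ?_⟩
  rw [tendsto_toWeakSpace_iff]
  intro y
  rw [tendsto_iff_ultrafilter]
  intro G hG
  obtain ⟨z', hz'⟩ := exists_weak_limit_ultrafilter hR G
  rw [huniq _ _ hof hG z z' hz hz']
  exact hz' y

end Weak

/-! ### The iteration and its convergence. -/

/-- The inexact relaxed variable metric forward-backward iteration with admissible parameters. -/
structure IsForwardBackwardIteration {H : Type*} [NormedAddCommGroup H] [InnerProductSpace ℝ H]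
    (A : H → Set H) (B : H → H) (β α : ℝ) (η : ℕ → ℝ) (U W : ℕ → H →L[ℝ] H) (m : ℝ)
    (γ lam : ℕ → ℝ) (a b x : ℕ → H) : Prop where
  maximal : IsMaximalMonotone A
  beta_pos : 0 < β
  cocoercive : IsCocoercive β B
  eta_nonneg : ∀ k, 0 ≤ η k
  eta_summable : Summable η
  pair : ∀ k, IsMetricPair α (U k) (W k)
  m_pos : 0 < m
  norm_le : ∀ k, ‖U k‖ ≤ m
  inner_le : ∀ k y, ⟪U k y, y⟫_ℝ ≤ (1 + η k) * ⟪U (k + 1) y, y⟫_ℝ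
  gamma_pos : ∀ k, 0 < γ k
  gamma_lt : ∀ k, γ k * ‖U k‖ < 2 * β
  lam_pos : ∀ k, 0 < lam k
  lam_lt : ∀ k, lam k < 1 / avgConst β (γ k) (U k)
  summable_a : Summable fun k => lam k * ‖a k‖
  summable_b : Summable fun k => lam k * ‖b k‖
  step : ∀ k, x (k + 1) = x k + lam k •
    (resolvent (scaledOp (γ k) (U k) A) (x k - γ k • U k (B (x k) + b k)) + a k - x k)

section Constants

variable {H : Type*} [NormedAddCommGroup H] [InnerProductSpace ℝ H] {α β γ : ℝ} {U W : H →L[ℝ] H}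

theorem one_div_avgConst (hβ : 0 < β) : 1 / avgConst β γ U = 2 - γ * ‖U‖ / (2 * β) := by
  rw [avgConst, one_div_div]
  field_simp
  ring

/-- The factor `⟪W v, v⟫` is kept because `α ≤ ‖U‖` fails on the zero space. -/
theorem mul_inner_inv_le_opNorm_mul (h : IsMetricPair α U W) (v : H) :
    α * ⟪W v, v⟫_ℝ ≤ ‖U‖ * ⟪W v, v⟫_ℝ := by
  by_cases hv : v = 0
  · simp [hv]
  · refine mul_le_mul_of_nonneg_right ?_ (h.nonneg_inv v)
    have h1 := h.coercive v
    have h2 := real_inner_le_norm (U v) v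
    have h3 := U.le_opNorm v
    have h4 : 0 < ‖v‖ ^ 2 := by have := norm_pos_iff.2 hv; positivity
    refine le_of_mul_le_mul_right ?_ h4
    nlinarith [norm_nonneg v]

end Constants

section Basic

namespace IsForwardBackwardIteration

variable {H : Type*} [NormedAddCommGroup H] [InnerProductSpace ℝ H] {A : H → Set H} {B : H → H}
  {β α m : ℝ} {η γ lam : ℕ → ℝ} {U W : ℕ → H →L[ℝ] H} {a b x : ℕ → H}

theorem lam_le (hI : IsForwardBackwardIteration A B β α η U W m γ lam a b x) (k : ℕ) :
    lam k ≤ 2 - γ k * ‖U k‖ / (2 * β) := by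
  have := hI.lam_lt k
  rw [one_div_avgConst hI.beta_pos] at this
  exact this.le

theorem lam_le_two (hI : IsForwardBackwardIteration A B β α η U W m γ lam a b x) (k : ℕ) :
    lam k ≤ 2 := by
  have h1 := hI.lam_le k
  have h2 : 0 ≤ γ k * ‖U k‖ / (2 * β) := by
    have := hI.gamma_pos k
    have := hI.beta_pos
    positivity
  linarith

theorem summable_error (hI : IsForwardBackwardIteration A B β α η U W m γ lam a b x) :
    Summable fun k => lam k * ((2 * β * ‖b k‖ + ‖a k‖) / √α) := by
  refine (((hI.summable_b.mul_left (2 * β)).add hI.summable_a).div_const √α).congr fun k => ?_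
  ring

theorem error_nonneg (hI : IsForwardBackwardIteration A B β α η U W m γ lam a b x) (k : ℕ) :
    0 ≤ lam k * ((2 * β * ‖b k‖ + ‖a k‖) / √α) := by
  have := hI.lam_pos k
  have := hI.beta_pos
  positivity

theorem step_eq (hI : IsForwardBackwardIteration A B β α η U W m γ lam a b x) (k : ℕ) :
    x (k + 1) = x k - lam k • (x k - fbOp A B (γ k) (U k) (x k)) + lam k •
      (resolvent (scaledOp (γ k) (U k) A) (x k - γ k • U k (B (x k) + b k))
        - fbOp A B (γ k) (U k) (x k) + a k) := by
  rw [hI.step k]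
  module

end IsForwardBackwardIteration

end Basic

variable {H : Type*} [NormedAddCommGroup H] [InnerProductSpace ℝ H] [CompleteSpace H]
  {A : H → Set H} {B : H → H} {β α γ : ℝ} {U W : H →L[ℝ] H}

theorem fbOp_eq_self (hA : IsMaximalMonotone A) (h : IsMetricPair α U W) (hγ : 0 < γ) {xs : H}
    (hxs : xs ∈ zer (addSingle A B)) : fbOp A B γ U xs = xs := by
  have h1 := inner_residual_nonneg hA h hγ xs hxs
  simp only [sub_self, smul_zero, zero_sub, sub_zero, inner_neg_left] at h1
  rw [← h.symm_inv] at h1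
  have h2 := h.sq_norm_le (m := ‖U‖ + 1) (by positivity) (by linarith) (xs - fbOp A B γ U xs)
  have h3 := h.nonneg_inv (xs - fbOp A B γ U xs)
  have h4 : ⟪W (xs - fbOp A B γ U xs), xs - fbOp A B γ U xs⟫_ℝ = 0 := by linarith
  rw [h4, mul_zero] at h2
  have h5 : ‖xs - fbOp A B γ U xs‖ ^ 2 = 0 := le_antisymm h2 (by positivity)
  exact (sub_eq_zero.1 (by simpa using h5)).symm

theorem metricNorm_error_le (hA : IsMaximalMonotone A) (h : IsMetricPair α U W) (hγ : 0 < γ)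
    (hγU : γ * ‖U‖ ≤ 2 * β) (x a b : H) :
    metricNorm W (resolvent (scaledOp γ U A) (x - γ • U (B x + b)) - fbOp A B γ U x + a) ≤
      (2 * β * ‖b‖ + ‖a‖) / √α := by
  refine (metricNorm_add_le h.symm_inv h.nonneg_inv _ _).trans ?_
  rw [add_div]
  refine add_le_add ?_ (h.metricNorm_inv_le a)
  refine (metricNorm_resolvent_sub_le hA h hγ _ _).trans ((h.metricNorm_inv_le _).trans ?_)
  gcongr
  have e : x - γ • U (B x + b) - (x - γ • U (B x)) = -(γ • U b) := by
    rw [map_add, smul_add]; abel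
  rw [e, norm_neg, norm_smul, Real.norm_of_nonneg hγ.le]
  calc γ * ‖U b‖ ≤ γ * (‖U‖ * ‖b‖) := by gcongr; exact U.le_opNorm b
    _ = γ * ‖U‖ * ‖b‖ := by ring
    _ ≤ _ := by gcongr

namespace IsForwardBackwardIteration

variable {η : ℕ → ℝ} {U W : ℕ → H →L[ℝ] H} {m : ℝ} {γ lam : ℕ → ℝ} {a b x : ℕ → H}

/-- Quasi-Fejér monotonicity of the iteration with respect to the zeros of `A + B`. -/
theorem tendsto_metricNorm_and_summable
    (hI : IsForwardBackwardIteration A B β α η U W m γ lam a b x) {xs : H}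
    (hxs : xs ∈ zer (addSingle A B)) :
    (∃ l, Tendsto (fun k => metricNorm (W k) (x k - xs)) atTop (𝓝 l)) ∧
    Summable fun k => lam k * (2 * ⟪W k (x k - xs), x k - fbOp A B (γ k) (U k) (x k)⟫_ℝ -
      (2 - γ k * ‖U k‖ / (2 * β)) *
      ⟪W k (x k - fbOp A B (γ k) (U k) (x k)), x k - fbOp A B (γ k) (U k) (x k)⟫_ℝ) := by
  have hβ := hI.beta_pos
  set v : ℕ → H := fun k => x k - fbOp A B (γ k) (U k) (x k) with hv
  refine tendsto_and_summable_of_sq_le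
    -- `t` is the distance after the exact relaxed step, still in the old metric; `e` bounds the
    -- effect of `a` and `b`.
    (t := fun k => metricNorm (W k) (x k - xs - lam k • v k))
    (η := η) (e := fun k => lam k * ((2 * β * ‖b k‖ + ‖a k‖) / √α))
    (fun k => metricNorm_nonneg _ _) (fun k => metricNorm_nonneg _ _) (fun k => ?_)
    hI.eta_nonneg hI.error_nonneg hI.eta_summable hI.summable_error (fun k => ?_) (fun k => ?_)
  · exact mul_nonneg (hI.lam_pos k).le (residual_gap_nonneg (hI.pair k) hβ (hI.gamma_pos k)
      (by field_simp) (hI.cocoercive _ _)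
      (inner_residual_nonneg hI.maximal (hI.pair k) (hI.gamma_pos k) (x k) hxs))
  · have hp := hI.pair k
    rw [metricNorm_sq hp.nonneg_inv, metricNorm_sq hp.nonneg_inv, quadratic_sub_smul hp.symm_inv]
    have h1 : lam k * lam k * ⟪W k (v k), v k⟫_ℝ ≤
        lam k * (2 - γ k * ‖U k‖ / (2 * β)) * ⟪W k (v k), v k⟫_ℝ :=
      mul_le_mul_of_nonneg_right (mul_le_mul_of_nonneg_left (hI.lam_le k) (hI.lam_pos k).le)
        (hp.nonneg_inv _)
    simp only [hv] at h1 ⊢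
    linarith
  · have hp := hI.pair k
    have hp' := hI.pair (k + 1)
    have hη := hI.eta_nonneg k
    rw [metricNorm_sq hp'.nonneg_inv]
    refine (hp.inner_inv_le_of_le hp' (by linarith) (hI.inner_le k) _).trans ?_
    rw [← metricNorm_sq hp.nonneg_inv]
    refine mul_le_mul_of_nonneg_left (pow_le_pow_left₀ (metricNorm_nonneg _ _) ?_ 2)
      (by linarith)
    rw [hI.step_eq k, show ∀ p q r : H, p - q + r - xs = p - xs - q + r by intros; abel]
    refine (metricNorm_add_le hp.symm_inv hp.nonneg_inv _ _).trans ?_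
    rw [metricNorm_smul, abs_of_pos (hI.lam_pos k)]
    refine add_le_add le_rfl (mul_le_mul_of_nonneg_left ?_ (hI.lam_pos k).le)
    exact metricNorm_error_le hI.maximal hp (hI.gamma_pos k) (hI.gamma_lt k).le _ _ _

theorem exists_norm_sub_le (hI : IsForwardBackwardIteration A B β α η U W m γ lam a b x) {xs : H}
    (hxs : xs ∈ zer (addSingle A B)) :
    ∃ R, 0 ≤ R ∧ (∀ k, metricNorm (W k) (x k - xs) ≤ R) ∧ ∀ k, ‖x k - xs‖ ≤ √m * R := by
  obtain ⟨⟨l, hl⟩, -⟩ := hI.tendsto_metricNorm_and_summable hxs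
  obtain ⟨R, hR⟩ := hl.bddAbove_range
  have h : ∀ k, metricNorm (W k) (x k - xs) ≤ R := fun k => hR ⟨k, rfl⟩
  exact ⟨R, (metricNorm_nonneg _ _).trans (h 0), h, fun k =>
    ((hI.pair k).norm_le_metricNorm hI.m_pos (hI.norm_le k) _).trans (by gcongr; exact h k)⟩

theorem norm_step_le (hI : IsForwardBackwardIteration A B β α η U W m γ lam a b x) (k : ℕ) :
    ‖x (k + 1) - x k‖ ≤ lam k * ‖x k - fbOp A B (γ k) (U k) (x k)‖ +
      √m * (lam k * ((2 * β * ‖b k‖ + ‖a k‖) / √α)) := by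
  have hp := hI.pair k
  have hlam := hI.lam_pos k
  rw [hI.step_eq k, show ∀ p q r : H, p - q + r - p = r - q by intros; abel]
  refine (norm_sub_le _ _).trans ?_
  rw [norm_smul, norm_smul, Real.norm_of_nonneg hlam.le, add_comm]
  refine add_le_add le_rfl ?_
  rw [mul_left_comm]
  refine mul_le_mul_of_nonneg_left ?_ hlam.le
  refine (hp.norm_le_metricNorm hI.m_pos (hI.norm_le k) _).trans
    (mul_le_mul_of_nonneg_left ?_ (Real.sqrt_nonneg _))
  exact metricNorm_error_le hI.maximal hp (hI.gamma_pos k) (hI.gamma_lt k).le _ _ _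

theorem summable_residual_pow_four
    (hI : IsForwardBackwardIteration A B β α η U W m γ lam a b x)
    (hΩ : (zer (addSingle A B)).Nonempty) {γlow ε : ℝ} (hγlow : 0 < γlow) (hε : 0 < ε)
    (hγl : ∀ k, γlow ≤ γ k) (hγu : ∀ k, γ k * ‖U k‖ ≤ 2 * β - ε) :
    Summable fun k => lam k * ‖x k - fbOp A B (γ k) (U k) (x k)‖ ^ 4 := by
  obtain ⟨xs, hxs⟩ := hΩ
  obtain ⟨R, hR0, hR, -⟩ := hI.exists_norm_sub_le hxs
  have hsum := (hI.tendsto_metricNorm_and_summable hxs).2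
  have hβ := hI.beta_pos
  have hm := hI.m_pos
  have hα := (hI.pair 0).pos
  -- Makes `c‖v‖² ≤ κ(1 - κ)⟪W v, v⟫`: the factors bound `κ` and `1 - κ` from below and pass from
  -- `W` to the norm.
  set c : ℝ := (γlow * α / (2 * β)) * (ε / (2 * β)) / m with hc
  have hc0 : 0 < c := by positivity
  refine Summable.of_nonneg_of_le (fun k => ?_) (fun k => ?_)
    (hsum.mul_left (16 * R ^ 2 / c ^ 2))
  · have := hI.lam_pos k
    positivity
  set v := x k - fbOp A B (γ k) (U k) (x k) with hv
  have hp := hI.pair k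
  have hκ : γ k * ‖U k‖ = 2 * β * (γ k * ‖U k‖ / (2 * β)) := by field_simp
  have hκ1 : γ k * ‖U k‖ / (2 * β) < 1 := by
    rw [div_lt_one (by positivity)]; exact hI.gamma_lt k
  have h1 := residual_sq_le_gap hp hβ (hI.gamma_pos k) hκ hκ1 (hI.cocoercive _ _)
      (inner_residual_nonneg hI.maximal hp (hI.gamma_pos k) (x k) hxs) (hR k)
  rw [← hv] at h1
  set κ := γ k * ‖U k‖ / (2 * β) with hκdef
  set N := ⟪W k v, v⟫_ℝ with hN
  have hN0 : 0 ≤ N := hp.nonneg_inv v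
  have h2 : γlow * α / (2 * β) * N ≤ κ * N := by
    have h3 : γlow * (α * N) ≤ γ k * (‖U k‖ * N) :=
      mul_le_mul (hγl k) (mul_inner_inv_le_opNorm_mul hp v) (by positivity) (hI.gamma_pos k).le
    rw [hκdef, div_mul_eq_mul_div, div_mul_eq_mul_div]
    gcongr ?_ / _
    linarith
  have h4 : ε / (2 * β) ≤ 1 - κ := by
    have := hγu k
    rw [hκdef, div_le_iff₀ (by positivity), sub_mul, div_mul_cancel₀ _ (by positivity)]
    linarith
  have h5 : ‖v‖ ^ 2 ≤ m * N := hp.sq_norm_le hm (hI.norm_le k) v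
  have h6 : c * ‖v‖ ^ 2 ≤ κ * (1 - κ) * N := by
    calc c * ‖v‖ ^ 2 ≤ c * (m * N) := by gcongr
      _ = (γlow * α / (2 * β) * N) * (ε / (2 * β)) := by rw [hc]; field_simp
      _ ≤ (κ * N) * (1 - κ) :=
          mul_le_mul h2 h4 (by positivity) (le_trans (by positivity) h2)
      _ = _ := by ring
  have h7 := (pow_le_pow_left₀ (by positivity) h6 2).trans h1
  set S := 2 * ⟪W k (x k - xs), v⟫_ℝ - (2 - κ) * N
  have h8 : lam k * (c ^ 2 * ‖v‖ ^ 4) ≤ lam k * (16 * R ^ 2 * S) := by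
    refine mul_le_mul_of_nonneg_left (le_trans (le_of_eq ?_) h7) (hI.lam_pos k).le
    ring
  rw [div_mul_eq_mul_div, le_div_iff₀ (by positivity)]
  linarith

/-- The residuals of the iteration vanish. -/
theorem tendsto_norm_residual (hI : IsForwardBackwardIteration A B β α η U W m γ lam a b x)
    (hΩ : (zer (addSingle A B)).Nonempty) {γlow ε : ℝ} (hγlow : 0 < γlow) (hε : 0 < ε)
    (hγl : ∀ k, γlow ≤ γ k) (hγu : ∀ k, γ k * ‖U k‖ ≤ 2 * β - ε)
    (hdiv : Tendsto (fun n => ∑ k ∈ Finset.range n, lam k) atTop atTop)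
    (hγs : Summable fun k => |γ (k + 1) - γ k|)
    (hWs : ∀ z : H, Summable fun k => ‖W k z - W (k + 1) z‖) :
    Tendsto (fun k => ‖x k - fbOp A B (γ k) (U k) (x k)‖) atTop (𝓝 0) := by
  have hsum := hI.summable_residual_pow_four hΩ hγlow hε hγl hγu
  obtain ⟨xs, hxs⟩ := hΩ
  obtain ⟨R, hR0, -, hR⟩ := hI.exists_norm_sub_le hxs
  have hm := hI.m_pos
  have hα := (hI.pair 0).pos
  set v : ℕ → H := fun k => x k - fbOp A B (γ k) (U k) (x k) with hv
  set L : ℝ := 1 + √m / √α * 3 with hL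
  have hL0 : 0 ≤ L := by positivity
  set e : ℕ → ℝ := fun k => lam k * ((2 * β * ‖b k‖ + ‖a k‖) / √α) with he
  set C : ℝ := L + m * (2 / α * L) with hC
  have hC0 : 0 ≤ C := by positivity
  refine tendsto_norm_zero_of_variation (fun k => W k - W (k + 1)) (fun z => by simpa using hWs z)
    v (C₁ := C) (C₂ := m) (L := 2) (lam := lam)
    (s := fun k => C * √m * e k + m * (L * (√m * R) / (α * γlow)) * |γ (k + 1) - γ k|)
    hC0 hm (fun k => (hI.lam_pos k).le) hI.lam_le_two
    ((hI.summable_error.mul_left _).add (hγs.mul_left _)) (fun k => ?_) hdiv hsum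
  have hp := hI.pair k
  -- Intermediate residual at the new point with the old parameters, separating the move in `x` from
  -- the change of `γ` and `U`.
  set w := x (k + 1) - fbOp A B (γ k) (U k) (x (k + 1)) with hw
  set Δ := ‖x (k + 1) - x k‖ with hΔ
  have hΔle : Δ ≤ lam k * ‖v k‖ + √m * e k := hI.norm_step_le k
  have h1 : ‖w - v k‖ ≤ L * Δ := norm_residual_sub_le hI.maximal hI.cocoercive hp
    (hI.gamma_pos k) (hI.gamma_lt k).le hm (hI.norm_le k) _ _
  have h2 : ‖w‖ ≤ L * (√m * R) := by
    have := norm_residual_sub_le hI.maximal hI.cocoercive hp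
      (hI.gamma_pos k) (hI.gamma_lt k).le hm (hI.norm_le k) (x (k + 1)) xs
    rw [fbOp_eq_self hI.maximal hp (hI.gamma_pos k) hxs, sub_self, sub_zero] at this
    exact this.trans (mul_le_mul_of_nonneg_left (hR _) hL0)
  have h3 : ‖v (k + 1) - w‖ ≤ m * (|γ (k + 1) - γ k| / γ k * (‖w‖ / α) +
      ‖W k w - W (k + 1) w‖) :=
    norm_residual_change_le hI.maximal hp (hI.pair (k + 1)) (hI.gamma_pos k)
      (hI.gamma_pos (k + 1)) hm (hI.norm_le (k + 1)) (x (k + 1))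
  have h4 : |γ (k + 1) - γ k| / γ k * (‖w‖ / α) ≤
      L * (√m * R) / (α * γlow) * |γ (k + 1) - γ k| := by
    calc _ ≤ |γ (k + 1) - γ k| / γlow * (L * (√m * R) / α) := by gcongr; exact hγl k
      _ = _ := by field_simp
  have hWb : ∀ j (z : H), ‖W j z‖ ≤ ‖z‖ / α := fun j z => by
    rw [le_div_iff₀ hα, mul_comm]; exact (hI.pair j).norm_inv_le z
  -- The metric increment is moved from `w` to `v k`, the form needed for absorption; the difference
  -- costs a multiple of the step length.
  have h5 : ‖W k w - W (k + 1) w‖ ≤ ‖W k (v k) - W (k + 1) (v k)‖ + 2 / α * (L * Δ) := by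
    have e1 : W k w - W (k + 1) w = (W k (v k) - W (k + 1) (v k)) +
        (W k (w - v k) - W (k + 1) (w - v k)) := by
      rw [map_sub (W k) w (v k), map_sub (W (k + 1)) w (v k)]; abel
    rw [e1]
    refine (norm_add_le _ _).trans (add_le_add le_rfl ((norm_sub_le _ _).trans ?_))
    calc _ ≤ ‖w - v k‖ / α + ‖w - v k‖ / α := add_le_add (hWb _ _) (hWb _ _)
      _ = 2 / α * ‖w - v k‖ := by ring
      _ ≤ _ := by gcongr
  have h6 : ‖v (k + 1) - v k‖ ≤ ‖v (k + 1) - w‖ + ‖w - v k‖ :=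
    norm_sub_le_norm_sub_add_norm_sub _ _ _
  have h7 := mul_le_mul_of_nonneg_left (add_le_add h4 h5) hm.le
  have h8 := mul_le_mul_of_nonneg_left hΔle hC0
  simp only [sub_apply]
  rw [hC] at h8 ⊢
  linarith

/-- The forward operator converges strongly along the iteration. -/
theorem tendsto_forward (hI : IsForwardBackwardIteration A B β α η U W m γ lam a b x)
    {γlow : ℝ} (hγlow : 0 < γlow) (hγl : ∀ k, γlow ≤ γ k)
    (hres : Tendsto (fun k => ‖x k - fbOp A B (γ k) (U k) (x k)‖) atTop (𝓝 0)) {xs : H}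
    (hxs : xs ∈ zer (addSingle A B)) : Tendsto (fun k => B (x k)) atTop (𝓝 (B xs)) := by
  obtain ⟨R, hR0, -, hR⟩ := hI.exists_norm_sub_le hxs
  have hβ := hI.beta_pos
  have hα := (hI.pair 0).pos
  set r := √m * R with hr
  have hr0 : 0 ≤ r := by positivity
  set C : ℝ := (r / (α * γlow) + r / β) / β with hC
  have hle : ∀ k, ‖B (x k) - B xs‖ ^ 2 ≤ C * ‖x k - fbOp A B (γ k) (U k) (x k)‖ := by
    intro k
    have hp := hI.pair k
    have hγk := hI.gamma_pos k
    have h1 := inner_residual_nonneg hI.maximal hp hγk (x k) hxs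
    set v := x k - fbOp A B (γ k) (U k) (x k) with hv
    set z := x k - xs with hz
    set d := B (x k) - B xs with hd
    have h2 : β * ‖d‖ ^ 2 ≤ ⟪z, d⟫_ℝ := hI.cocoercive _ _
    have h3 : ‖d‖ ≤ r / β := by
      rw [le_div_iff₀ hβ, mul_comm]
      exact (hI.cocoercive.norm_sub_le _ _).trans (hR k)
    simp only [inner_sub_left, inner_sub_right, inner_smul_right] at h1
    have h4 : 0 ≤ ⟪v, W k v⟫_ℝ := by rw [← hp.symm_inv]; exact hp.nonneg_inv v
    have h5 : ⟪z, W k v⟫_ℝ ≤ r * (‖v‖ / α) := by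
      refine (real_inner_le_norm _ _).trans (mul_le_mul (hR k) ?_ (norm_nonneg _) hr0)
      rw [le_div_iff₀ hα, mul_comm]; exact hp.norm_inv_le v
    have h6 : ⟪v, d⟫_ℝ ≤ ‖v‖ * (r / β) :=
      (real_inner_le_norm _ _).trans (mul_le_mul_of_nonneg_left h3 (norm_nonneg _))
    have h7 : γ k * ⟪z, d⟫_ℝ ≤ γ k * (r * (‖v‖ / α) / γlow + ‖v‖ * (r / β)) := by
      have h8 : γlow * (r * (‖v‖ / α) / γlow) ≤ γ k * (r * (‖v‖ / α) / γlow) := by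
        gcongr; exact hγl k
      rw [mul_div_cancel₀ _ hγlow.ne'] at h8
      have h9 := mul_le_mul_of_nonneg_left h6 hγk.le
      linarith
    have h10 := h2.trans (le_of_mul_le_mul_left h7 hγk)
    have h11 : r * (‖v‖ / α) / γlow + ‖v‖ * (r / β) = β * (C * ‖v‖) := by
      rw [hC]; field_simp
    rw [h11] at h10
    exact le_of_mul_le_mul_left h10 hβ
  rw [tendsto_iff_norm_sub_tendsto_zero]
  have h1 : Tendsto (fun k => ‖B (x k) - B xs‖ ^ 2) atTop (𝓝 0) :=
    squeeze_zero (fun k => by positivity) hle (by simpa using hres.const_mul C)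
  simpa using h1.sqrt

/-- Weak cluster points of the iteration are zeros of `A + B`. -/
theorem mem_zer_of_weak_limit (hI : IsForwardBackwardIteration A B β α η U W m γ lam a b x)
    (hΩ : (zer (addSingle A B)).Nonempty) {γlow : ℝ} (hγlow : 0 < γlow)
    (hγl : ∀ k, γlow ≤ γ k)
    (hres : Tendsto (fun k => ‖x k - fbOp A B (γ k) (U k) (x k)‖) atTop (𝓝 0))
    {F : Filter ℕ} [F.NeBot] (hF : F ≤ atTop) {z : H}
    (hz : ∀ y, Tendsto (fun k => ⟪x k, y⟫_ℝ) F (𝓝 ⟪z, y⟫_ℝ)) : z ∈ zer (addSingle A B) := by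
  obtain ⟨xs, hxs⟩ := hΩ
  obtain ⟨R, hR0, -, hR⟩ := hI.exists_norm_sub_le hxs
  have hβ := hI.beta_pos
  have hα := (hI.pair 0).pos
  have hBx := (hI.tendsto_forward hγlow hγl hres hxs).mono_left hF
  set v : ℕ → H := fun k => x k - fbOp A B (γ k) (U k) (x k) with hv
  have hv0 : Tendsto v F (𝓝 0) := (tendsto_zero_iff_norm_tendsto_zero.2 hres).mono_left hF
  obtain ⟨V, hV⟩ := hres.bddAbove_range
  have hVk : ∀ k, ‖v k‖ ≤ V := fun k => hV ⟨k, rfl⟩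
  have hxb : ∀ k, ‖x k‖ ≤ √m * R + ‖xs‖ := fun k => by
    have := norm_add_le (x k - xs) xs
    rw [sub_add_cancel] at this
    linarith [hR k]
  have hshift : ∀ q y : H, Tendsto (fun k => ⟪x k - v k - q, y⟫_ℝ) F (𝓝 ⟪z - q, y⟫_ℝ) := by
    intro q y
    have h1 := ((hz y).sub (hv0.inner (tendsto_const_nhds (x := y)))).sub_const ⟪q, y⟫_ℝ
    simp only [inner_zero_left, sub_zero] at h1
    simpa only [inner_sub_left] using h1
  -- In the cocoercivity inequality for `x k` and `z`, the right side pairs a weakly null sequence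
  -- with a strongly convergent one.
  have hforward : B z = B xs := by
    have h1 := tendsto_inner_of_weak_of_strong (p := fun k => x k - z)
      (R := √m * R + ‖xs‖ + ‖z‖) (p₀ := 0)
      (fun k => (norm_sub_le _ _).trans (by linarith [hxb k]))
      (fun y => by simpa only [inner_sub_left, sub_self, inner_zero_left] using
        (hz y).sub_const ⟪z, y⟫_ℝ)
      (hBx.sub_const (B z))
    have h2 := le_of_tendsto_of_tendsto' (((hBx.sub_const (B z)).norm.pow 2).const_mul β) h1
      fun k => hI.cocoercive (x k) z
    rw [inner_zero_left] at h2
    have h3 : ‖B xs - B z‖ ^ 2 ≤ 0 := nonpos_of_mul_nonpos_right h2 hβ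
    have h4 : ‖B xs - B z‖ ^ 2 = 0 := le_antisymm h3 (by positivity)
    exact (sub_eq_zero.1 (by simpa using h4)).symm
  have hbackward : Tendsto (fun k => (γ k)⁻¹ • W k (v k) - B (x k)) F (𝓝 (-B xs)) := by
    have h1 : Tendsto (fun k => (γ k)⁻¹ • W k (v k)) F (𝓝 0) := by
      refine squeeze_zero_norm (a := fun k => γlow⁻¹ * (‖v k‖ / α)) (fun k => ?_) ?_
      · have hγk := hI.gamma_pos k
        rw [norm_smul, norm_inv, Real.norm_of_nonneg hγk.le]
        have h2 : ‖W k (v k)‖ ≤ ‖v k‖ / α := by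
          rw [le_div_iff₀ hα, mul_comm]; exact (hI.pair k).norm_inv_le _
        have h3 := hγl k
        gcongr
      · have := ((hv0.norm.div_const α).const_mul γlow⁻¹)
        simpa using this
    simpa using h1.sub hBx
  refine mem_zer_of_neg_mem ?_
  rw [hforward]
  refine hI.maximal.mem_of_forall fun q w hw => ?_
  have h1 := tendsto_inner_of_weak_of_strong (R := √m * R + ‖xs‖ + V + ‖q‖)
    (fun k => by
      have h2 := norm_sub_le (x k - v k) q
      have h3 := norm_sub_le (x k) (v k)
      linarith [hxb k, hVk k]) (hshift q) (hbackward.sub_const w)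
  refine ge_of_tendsto' h1 fun k => ?_
  have h2 := hI.maximal.1 _ _ _ (smul_map_residual_sub_mem (B := B) hI.maximal (hI.pair k)
    (hI.gamma_pos k) (x k)) _ hw
  simpa only [hv, sub_sub_cancel] using h2

theorem exists_weak_limit (hI : IsForwardBackwardIteration A B β α η U W m γ lam a b x)
    (hΩ : (zer (addSingle A B)).Nonempty) {γlow : ℝ} (hγlow : 0 < γlow)
    (hγl : ∀ k, γlow ≤ γ k)
    (hres : Tendsto (fun k => ‖x k - fbOp A B (γ k) (U k) (x k)‖) atTop (𝓝 0))
    (hWs : ∀ z : H, Summable fun k => ‖W k z - W (k + 1) z‖) :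
    ∃ z ∈ zer (addSingle A B),
      Tendsto (fun k => toWeakSpace ℝ H (x k)) atTop (𝓝 (toWeakSpace ℝ H z)) := by
  obtain ⟨xs, hxs⟩ := id hΩ
  obtain ⟨R, hR0, -, hR⟩ := hI.exists_norm_sub_le hxs
  have hm := hI.m_pos
  refine exists_weak_limit_of_tendsto_metricNorm (R := √m * R + ‖xs‖) (fun k => ?_)
    (fun k => (hI.pair k).symm_inv) (inv_pos.2 hm) (fun k y => ?_) (fun y => ?_) _
    (fun y hy => (hI.tendsto_metricNorm_and_summable hy).1)
    (fun F hF y hy => hI.mem_zer_of_weak_limit hΩ hγlow hγl hres hF hy)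
  · have := norm_add_le (x k - xs) xs
    rw [sub_add_cancel] at this
    linarith [hR k]
  · rw [inv_mul_le_iff₀ hm]
    exact (hI.pair k).sq_norm_le hm (hI.norm_le k) y
  · refine cauchySeq_tendsto_of_complete (cauchySeq_of_summable_dist ?_)
    simpa only [dist_eq_norm] using hWs y

end IsForwardBackwardIteration

end VMFB

/-! ### The main theorem. -/

theorem theorem3p2 {H : Type*} [NormedAddCommGroup H] [InnerProductSpace ℝ H] [CompleteSpace H]
    (A : H → Set H) (hA : VMFB.IsMaximalMonotone A)
    (B : H → H) (β : ℝ) (hβ : 0 < β) (hB : VMFB.IsCocoercive β B)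
    (hΩ : (VMFB.zer (VMFB.addSingle A B)).Nonempty)
    (α : ℝ) (hα : 0 < α)
    (η : ℕ → ℝ) (hη0 : ∀ k, 0 ≤ η k) (hη : Summable η)
    (U : ℕ → H →L[ℝ] H) (hU : ∀ k, U k ∈ VMFB.strongPos α)
    (μ : ℝ) (hμ : IsLUB (Set.range fun k => ‖U k‖) μ)
    (hUmono : ∀ k, U k ≤ (1 + η k) • U (k + 1))
    (γ : ℕ → ℝ) (hγ0 : ∀ k, 0 < γ k) (hγ : ∀ k, γ k * ‖U k‖ < 2 * β)
    (lam : ℕ → ℝ) (hlam0 : ∀ k, 0 < lam k)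
    (hlam : ∀ k, lam k < 1 / VMFB.avgConst β (γ k) (U k))
    (a b : ℕ → H)
    (ha : Summable fun k => lam k * ‖a k‖) (hb : Summable fun k => lam k * ‖b k‖)
    (x y : ℕ → H)
    (hy : ∀ k, y k = x k - γ k • U k (B (x k) + b k))
    (hx : ∀ k, x (k + 1) = x k +
      lam k • (VMFB.resolvent (VMFB.scaledOp (γ k) (U k) A) (y k) + a k - x k)) :
    (∀ xs ∈ VMFB.zer (VMFB.addSingle A B), ∃ l : ℝ,
      Tendsto (fun k => VMFB.metricNorm (U k).inverse (x k - xs)) atTop (𝓝 l)) ∧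
    ((Tendsto (fun n => ∑ k ∈ Finset.range n,
        lam k * (1 / VMFB.avgConst β (γ k) (U k) - lam k)) atTop atTop) →
      (∃ γlow ε : ℝ, 0 < γlow ∧ 0 < ε ∧ ε < 2 * β - μ * γlow ∧
        ∀ k, γlow ≤ γ k ∧ γ k * μ ≤ 2 * β - ε) →
      (Summable fun k => |γ (k + 1) - γ k|) →
      (Summable fun k => |γ (k + 1) * ‖U (k + 1)‖ - γ k * ‖U k‖|) →
      (∀ z : H, Summable fun k => ‖(U k).inverse z - (U (k + 1)).inverse z‖) →
      Tendsto (fun k => ‖x k - VMFB.fbOp A B (γ k) (U k) (x k)‖) atTop (𝓝 0) ∧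
      (∃ xbar ∈ VMFB.zer (VMFB.addSingle A B),
        Tendsto (fun k => toWeakSpace ℝ H (x k)) atTop (𝓝 (toWeakSpace ℝ H xbar))) ∧
      ((∃ lamlow : ℝ, 0 < lamlow ∧ ∀ k, lamlow ≤ lam k) →
        ∀ xs ∈ VMFB.zer (VMFB.addSingle A B),
          Tendsto (fun k => B (x k)) atTop (𝓝 (B xs)))) := by
  have hUμ : ∀ k, ‖U k‖ ≤ μ := fun k => hμ.1 ⟨k, rfl⟩
  have hμ0 : 0 ≤ μ := (norm_nonneg _).trans (hUμ 0)
  -- The bound `μ + 1` is used because `μ` vanishes on the zero space and the estimates need a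
  -- positive constant.
  have hI : VMFB.IsForwardBackwardIteration A B β α η U (fun k => (U k).inverse) (μ + 1)
      γ lam a b x :=
    { maximal := hA
      beta_pos := hβ
      cocoercive := hB
      eta_nonneg := hη0
      eta_summable := hη
      pair := fun k => VMFB.isMetricPair_inverse hα (hU k)
      m_pos := by linarith
      norm_le := fun k => by linarith [hUμ k]
      inner_le := fun k y => by
        have h := ((ContinuousLinearMap.le_def _ _).1 (hUmono k)).2 y
        rw [ContinuousLinearMap.reApplyInnerSelf_apply] at h
        simp only [sub_apply, smul_apply, inner_sub_left, inner_smul_left, RCLike.re_to_real,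
          conj_trivial] at h
        linarith
      gamma_pos := hγ0
      gamma_lt := hγ
      lam_pos := hlam0
      lam_lt := hlam
      summable_a := ha
      summable_b := hb
      step := fun k => by rw [hx k, hy k] }
  refine ⟨fun xs hxs => (hI.tendsto_metricNorm_and_summable hxs).1, ?_⟩
  rintro hdiv ⟨γlow, ε, hγlow, hε, -, hb'⟩ hγs - hWs
  have hγl : ∀ k, γlow ≤ γ k := fun k => (hb' k).1
  have hγu : ∀ k, γ k * ‖U k‖ ≤ 2 * β - ε := fun k =>
    (mul_le_mul_of_nonneg_left (hUμ k) (hγ0 k).le).trans (hb' k).2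
  -- Each weight in (a) is at most `2 * lam k`, because `1 / avgConst ≤ 2`.
  have hdiv' : Tendsto (fun n => ∑ k ∈ Finset.range n, lam k) atTop atTop := by
    rw [← tendsto_const_mul_atTop_of_pos (zero_lt_two (α := ℝ))]
    refine tendsto_atTop_mono (fun n => ?_) hdiv
    rw [Finset.mul_sum]
    refine Finset.sum_le_sum fun k _ => ?_
    rw [mul_comm 2]
    refine mul_le_mul_of_nonneg_left ?_ (hlam0 k).le
    rw [VMFB.one_div_avgConst hβ]
    have h1 := hlam0 k
    have h2 : 0 ≤ γ k * ‖U k‖ / (2 * β) := by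
      have := hγ0 k
      positivity
    linarith
  have hres := hI.tendsto_norm_residual hΩ hγlow hε hγl hγu hdiv' hγs hWs
  exact ⟨hres, hI.exists_weak_limit hΩ hγlow hγl hres hWs,
    fun _ xs hxs => hI.tendsto_forward hγlow hγl hres hxs⟩
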